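/- **Setting.** All logarithms are to base $2$. Let $P$ and $Q$ be probability distributions on finite sets $\mathcal X$ and $\mathcal Y$. Put $H(P)=-\sum_x P(x)\log P(x)$ and $V(Q)=\sum_y Q(y)(-\log Q(y)-H(Q))^2$. Let $P^n$ be the $n$-fold i.i.d. distribution. Let $F(Q,Q')=\sum_y\sqrt{Q(y)Q'(y)}$ be the fidelity, and let $\Phi$ be the standard normal distribution function. Write $P\prec Q$ if for every $l$ the sum of the $l$ largest values of $P$ is at most that of $Q$. For $N\in\mathbb N$ define the maximal fidelities through a storage of $N$ bits by $$F^{\mathcal D}(P\to Q|N)=\sup\{F(W'\circ W(P),Q): W:\mathcal X\to\{0,1\}^N,\ W':\{0,1\}^N\to\mathcal Y\},$$ $$F^{\mathcal M}(P\to Q|N)=\sup\{F(P'',Q): P\prec P'\prec P'',\ P'\text{ a distribution on }\{0,1\}^N,\ P''\text{ one on }\mathcal Y\},$$ where $W(P)$ is the image distribution. **First-order rates.** For $i\in\{\mathcal D,\mathcal M\}$ and $\nu\in(0,1)$, a sequence $(S_n,T_n)$ of pairs of natural numbers is $\nu$-achievable if $\liminf_{n\to\infty} F^i(P^n\to Q^{T_n}|S_n)\ge\nu$.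 A pair $(s_1,t_1)$ of positive reals is $\nu$-achievable if some sequence with $S_n=s_1n+o(n)$ and $T_n=t_1n+o(n)$ is $\nu$-achievable. A pair $(s,t)$ is better than $(s',t')$ if there are sequences $S_n=sn+o(n)$, $T_n=tn+o(n)$, $S'_n=s'n+o(n)$, $T'_n=t'n+o(n)$ with $S_n\le S'_n$ and $T_n\ge T'_n$ for all large $n$. It simulates $(s',t')$ if there are such sequences with $(S'_n,T'_n)=(S_{a_nn},T_{a_nn})$ for some $a_n\in(0,1]$ with $a_nn\in\mathbb N$, for all $n\ge 1$. A $\nu$-achievable pair is semi-admissible if no other $\nu$-achievable pair is better than it, and admissible if no other $\nu$-achievable pair is better than it or simulates it. **Second-order rates.** For $s_2,t_2\in\mathbb R$ put $$F^i_{P,Q,s_1,t_1,s_2}(t_2)=\liminf_{n\to\infty}F^i\bigl(P^n\to Q^{t_1n+t_2\sqrt n}\,\big|\,s_1n+s_2\sqrt n\bigr)$$ (real numbers rounded down to natural numbers, negative ones to $0$), and $\mathcal R^{2,i}_{P,Q}(s_1,t_1,\nu)=\{(s_2,t_2): F^i_{P,Q,s_1,t_1,s_2}(t_2)\ge\nu\}$.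 **Theorem.** Suppose that $Q$ is not the uniform distribution on its support (equivalently $V(Q)>0$), and that $(s_1,t_1)$ is semi-admissible but not admissible, for one of the two conversion types and some $\nu_0\in(0,1)$. Then $0<s_1<H(P)$ and $t_1=s_1/H(Q)$. For every $s_2\in\mathbb R$ the function $$F_{P,Q,s_1,t_1,s_2}(t_2)=\sqrt{\Phi\left(\sqrt{\frac{H(Q)}{V(Q)s_1}}\,(s_2-H(Q)t_2)\right)}$$ is continuous on $\mathbb R$ and strictly decreasing on $F_{P,Q,s_1,t_1,s_2}^{-1}((0,1))$, and for all $t_2\in\mathbb R$ $$F_{P,Q,s_1,t_1,s_2}(t_2)=F^{\mathcal D}_{P,Q,s_1,t_1,s_2}(t_2)=F^{\mathcal M}_{P,Q,s_1,t_1,s_2}(t_2).$$ Moreover, for both $i$, $\liminf_n F^i(P^n\to Q^{T_n}|S_n)=F_{P,Q,s_1,t_1,s_2}(t_2)$ for all sequences of natural numbers with $S_n=s_1n+s_2\sqrt n+o(\sqrt n)$ and $T_n=t_1n+t_2\sqrt n+o(\sqrt n)$. Consequently, for every $\nu\in(0,1)$, $$\mathcal R^{2,\mathcal D}_{P,Q}(s_1,t_1,\nu)=\mathcal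 R^{2,\mathcal M}_{P,Q}(s_1,t_1,\nu)=\left\{(s_2,t_2): t_2\le\frac{s_2}{H(Q)}-\sqrt{\frac{V(Q)s_1}{H(Q)^3}}\,\Phi^{-1}(\nu^2)\right\}.$$ -/

import Mathlib

open Filter Asymptotics

noncomputable section

namespace RNC

/-! ### Distributions on finite sets: a distribution is an element of `stdSimplex ℝ X`. -/

/-- Shannon entropy in bits. -/
def entropy {X : Type*} [Fintype X] (P : X → ℝ) : ℝ :=
  -∑ x, P x * Real.logb 2 (P x)

/-- The varentropy `V(P) = ∑ P(x) (-log₂ P(x) - H(P))²`. -/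
def varentropy {X : Type*} [Fintype X] (P : X → ℝ) : ℝ :=
  ∑ x, P x * (-Real.logb 2 (P x) - entropy P) ^ 2

/-- The `n`-fold i.i.d. distribution `Pⁿ`. -/
def iid {X : Type*} (P : X → ℝ) (n : ℕ) : (Fin n → X) → ℝ :=
  fun x => ∏ k, P (x k)

open Classical in
/-- The image distribution `W(P)`. -/
def pushforward {X Y : Type*} [Fintype X] (W : X → Y) (P : X → ℝ) : Y → ℝ :=
  fun y => ∑ x, if W x = y then P x else 0

/-- The fidelity (Bhattacharyya coefficient). -/
def fidelity {Y : Type*} [Fintype Y] (Q Q' : Y → ℝ) : ℝ :=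
  ∑ y, Real.sqrt (Q y) * Real.sqrt (Q' y)

/-- The sum of the `l` largest values of a nonnegative function `P` (all of them, if there are fewer
than `l`): the largest sum of `P` over a set of at most `l` points. -/
def topSum {X : Type*} (P : X → ℝ) (l : ℕ) : ℝ :=
  ⨆ A : {A : Finset X // A.card ≤ l}, ∑ x ∈ A.1, P x

/-- `P ≺ Q` : `P` is majorized by `Q`; the underlying finite sets may differ. -/
def MajorizedBy {X Y : Type*} (P : X → ℝ) (Q : Y → ℝ) : Prop :=
  ∀ l : ℕ, topSum P l ≤ topSum Q l

/-- The storage of `N` bits. -/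
abbrev Bits (N : ℕ) : Type := Fin N → Bool

/-- The two kinds of conversion: deterministic and majorization conversions. -/
inductive ConvType : Type
  | det : ConvType
  | maj : ConvType

/-- The maximal fidelity of deterministic conversions from `P` to `Q` through `N` bits. -/
def fidelityDet {X Y : Type*} [Fintype X] [Fintype Y] (P : X → ℝ) (Q : Y → ℝ) (N : ℕ) : ℝ :=
  sSup {f : ℝ | ∃ (W : X → Bits N) (W' : Bits N → Y), f = fidelity (pushforward (W' ∘ W) P) Q}

/-- The maximal fidelity of majorization conversions from `P` to `Q` through `N` bits. -/
def fidelityMaj {X Y : Type*} [Fintype X] [Fintype Y] (P : X → ℝ) (Q : Y → ℝ) (N : ℕ) : ℝ :=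
  sSup {f : ℝ | ∃ P' ∈ stdSimplex ℝ (Bits N), ∃ P'' ∈ stdSimplex ℝ Y,
    MajorizedBy P P' ∧ MajorizedBy P' P'' ∧ f = fidelity P'' Q}

/-- The maximal fidelity `Fⁱ(P → Q | N)`. -/
def maxFidelity {X Y : Type*} [Fintype X] [Fintype Y] (i : ConvType) (P : X → ℝ) (Q : Y → ℝ)
    (N : ℕ) : ℝ :=
  match i with
  | ConvType.det => fidelityDet P Q N
  | ConvType.maj => fidelityMaj P Q N

/-- `liminf Fⁱ(Pⁿ → Q^(T n) | S n)`. -/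
def asympFidelity {X Y : Type*} [Fintype X] [Fintype Y] (i : ConvType) (P : X → ℝ) (Q : Y → ℝ)
    (S T : ℕ → ℕ) : ℝ :=
  liminf (fun n : ℕ => maxFidelity i (iid P n) (iid Q (T n)) (S n)) atTop

/-- The sequence `(S n, T n)` is `ν`-achievable. -/
def Achievable {X Y : Type*} [Fintype X] [Fintype Y] (i : ConvType) (P : X → ℝ) (Q : Y → ℝ)
    (ν : ℝ) (S T : ℕ → ℕ) : Prop :=
  ν ≤ asympFidelity i P Q S T

/-- `(S, T)` is better than `(S', T')`. -/
def SeqBetter (S T S' T' : ℕ → ℕ) : Prop :=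
  ∀ᶠ n in atTop, S n ≤ S' n ∧ T' n ≤ T n

/-- `(S, T)` simulates `(S', T')` : `(S' n, T' n) = (S (aₙ n), T (aₙ n))` with `0 < aₙ ≤ 1`;
here `k n = aₙ n`. -/
def SeqSimulates (S T S' T' : ℕ → ℕ) : Prop :=
  ∃ k : ℕ → ℕ, ∀ n, 1 ≤ n → 1 ≤ k n ∧ k n ≤ n ∧ S' n = S (k n) ∧ T' n = T (k n)

/-! ### First-order rates -/

/-- `S n = s n + o(n)`. -/
def HasRate (S : ℕ → ℕ) (s : ℝ) : Prop :=
  (fun n : ℕ => (S n : ℝ) - s * n) =o[atTop] (fun n : ℕ => (n : ℝ))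

/-- The first-order rate region: the pairs `(s₁, t₁)` of positive rates of `ν`-achievable sequences
`(s₁ n + o(n), t₁ n + o(n))`. -/
def firstOrderRegion {X Y : Type*} [Fintype X] [Fintype Y] (i : ConvType) (P : X → ℝ) (Q : Y → ℝ)
    (ν : ℝ) : Set (ℝ × ℝ) :=
  {r | 0 < r.1 ∧ 0 < r.2 ∧
    ∃ S T : ℕ → ℕ, HasRate S r.1 ∧ HasRate T r.2 ∧ Achievable i P Q ν S T}

/-- The rate pair `r` is better than `r'`. -/
def RateBetter (r r' : ℝ × ℝ) : Prop :=
  ∃ S T S' T' : ℕ → ℕ, HasRate S r.1 ∧ HasRate T r.2 ∧ HasRate S' r'.1 ∧ HasRate T' r'.2 ∧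
    SeqBetter S T S' T'

/-- The rate pair `r` simulates `r'`. -/
def RateSimulates (r r' : ℝ × ℝ) : Prop :=
  ∃ S T S' T' : ℕ → ℕ, HasRate S r.1 ∧ HasRate T r.2 ∧ HasRate S' r'.1 ∧ HasRate T' r'.2 ∧
    SeqSimulates S T S' T'

/-- No achievable rate pair except `r` itself is better than the achievable rate pair `r`. -/
def SemiAdmissible {X Y : Type*} [Fintype X] [Fintype Y] (i : ConvType) (P : X → ℝ) (Q : Y → ℝ)
    (ν : ℝ) (r : ℝ × ℝ) : Prop :=
  r ∈ firstOrderRegion i P Q ν ∧ ∀ r' ∈ firstOrderRegion i P Q ν, RateBetter r' r → r' = r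

/-- No achievable rate pair except `r` itself is better than or simulates the achievable rate
pair `r`. -/
def Admissible {X Y : Type*} [Fintype X] [Fintype Y] (i : ConvType) (P : X → ℝ) (Q : Y → ℝ)
    (ν : ℝ) (r : ℝ × ℝ) : Prop :=
  r ∈ firstOrderRegion i P Q ν ∧
    ∀ r' ∈ firstOrderRegion i P Q ν, (RateBetter r' r ∨ RateSimulates r' r) → r' = r

/-! ### Second-order rates -/

/-- `S n = s₁ n + s₂ √n + o(√n)`. -/
def HasRate₂ (S : ℕ → ℕ) (s₁ s₂ : ℝ) : Prop :=
  (fun n : ℕ => (S n : ℝ) - (s₁ * n + s₂ * Real.sqrt n)) =o[atTop] (fun n : ℕ => Real.sqrt n)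

/-- `n ↦ s₁ n + s₂ √n`, rounded down to a natural number. -/
def rateSeq (s₁ s₂ : ℝ) (n : ℕ) : ℕ := ⌊s₁ * n + s₂ * Real.sqrt n⌋₊

/-- The second-order fidelity `liminf Fⁱ(Pⁿ → Q^(t₁ n + t₂ √n) | s₁ n + s₂ √n)`. -/
def secondOrderFidelity {X Y : Type*} [Fintype X] [Fintype Y] (i : ConvType) (P : X → ℝ)
    (Q : Y → ℝ) (s₁ t₁ s₂ t₂ : ℝ) : ℝ :=
  asympFidelity i P Q (rateSeq s₁ s₂) (rateSeq t₁ t₂)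

/-- The second-order rate region at the first-order rate pair `(s₁, t₁)`. -/
def secondOrderRegion {X Y : Type*} [Fintype X] [Fintype Y] (i : ConvType) (P : X → ℝ)
    (Q : Y → ℝ) (s₁ t₁ ν : ℝ) : Set (ℝ × ℝ) :=
  {r | ν ≤ secondOrderFidelity i P Q s₁ t₁ r.1 r.2}

/-- The distribution function `Φ` of the standard normal distribution. -/
def stdNormalCDF (x : ℝ) : ℝ :=
  ProbabilityTheory.cdf (ProbabilityTheory.gaussianReal 0 1) x

/-- The inverse function `Φ⁻¹`, meaningful on `(0, 1)`. -/
def stdNormalInv : ℝ → ℝ := Function.invFun stdNormalCDF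

/-- `√Φ(√(H(Q) / (V(Q) s₁)) (s₂ - H(Q) t₂))`. -/
def gaussianFidelity {Y : Type*} [Fintype Y] (Q : Y → ℝ) (s₁ s₂ t₂ : ℝ) : ℝ :=
  Real.sqrt (stdNormalCDF
    (Real.sqrt (entropy Q / (varentropy Q * s₁)) * (s₂ - entropy Q * t₂)))

end RNC

end

/-! The fidelity is governed by the distribution function `infoCDF` of the information content,
whose asymptotics are given by the central limit theorem. Upper bounds: Cauchy–Schwarz on a set and
its complement (`fidelity_le_sqrt_add_sqrt`), applied to the heaviest points, bounds even the
majorization fidelity. A distribution on `2 ^ N` points covers at most the top `2 ^ N` masses of the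
target. Independently of the storage, if `K` points nearly exhaust the source but carry little
target mass, the fidelity is small. Lower bound: if the source consists mostly of atoms lighter than
`2 ^ (-N)`, they can be packed into bins shaped like the heavy part of the target
(`sqrt_le_fidelityDet`), so even deterministic conversions attain the first bound up to a slack of
`c` bits. To first order, the achievable pairs therefore satisfy `t * H(Q) ≤ min s H(P)`.
Semi-admissibility forces `s = t * H(Q)`. At `s = H(P)` such a pair is admissible, because
simulation preserves the ratio of the rates and cannot increase them. Thus the remaining case is `s
< H(P)`: the source is rich enough not to matter, and the fidelity is asymptotically the square root
of the mass of the `2 ^ (S n)` likeliest words of the target, which is Gaussian on the scale `√n`.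
-/

namespace RNC

/-! ### Sums of largest values -/

section TopSum

variable {X Y : Type*}

theorem sum_le_topSum [Fintype X] (P : X → ℝ) {l : ℕ} {A : Finset X} (hA : A.card ≤ l) :
    ∑ x ∈ A, P x ≤ topSum P l :=
  le_ciSup (f := fun A : {A : Finset X // A.card ≤ l} => ∑ x ∈ A.1, P x)
    (Set.finite_range _).bddAbove ⟨A, hA⟩

theorem topSum_le {P : X → ℝ} {l : ℕ} {c : ℝ}
    (h : ∀ A : Finset X, A.card ≤ l → ∑ x ∈ A, P x ≤ c) : topSum P l ≤ c := by
  have : Nonempty {A : Finset X // A.card ≤ l} := ⟨⟨∅, by simp⟩⟩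
  exact ciSup_le fun A => h A.1 A.2

theorem exists_sum_eq_topSum [Fintype X] (P : X → ℝ) (l : ℕ) :
    ∃ A : Finset X, A.card ≤ l ∧ ∑ x ∈ A, P x = topSum P l := by
  have : Nonempty {A : Finset X // A.card ≤ l} := ⟨⟨∅, by simp⟩⟩
  obtain ⟨A, hA⟩ := exists_eq_ciSup_of_finite
    (f := fun A : {A : Finset X // A.card ≤ l} => ∑ x ∈ A.1, P x)
  exact ⟨A.1, A.2, hA⟩

theorem sum_le_one_of_mem_stdSimplex [Fintype X] {P : X → ℝ} (hP : P ∈ stdSimplex ℝ X)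
    (A : Finset X) : ∑ x ∈ A, P x ≤ 1 := by
  rw [← hP.2]
  exact Finset.sum_le_sum_of_subset_of_nonneg (Finset.subset_univ _) fun x _ _ => hP.1 x

end TopSum

/-! ### Image distributions and majorization -/

section Pushforward

variable {X Y Z : Type*} [Fintype X]

open Classical in
theorem pushforward_eq_sum_filter (W : X → Y) (P : X → ℝ) (y : Y) :
    pushforward W P y = ∑ x with W x = y, P x := by
  simp [pushforward, Finset.sum_filter]

theorem pushforward_mem_stdSimplex [Fintype Y] {P : X → ℝ} (hP : P ∈ stdSimplex ℝ X)
    (W : X → Y) : pushforward W P ∈ stdSimplex ℝ Y := by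
  classical
  refine ⟨fun y => ?_, ?_⟩
  · rw [pushforward_eq_sum_filter]
    exact Finset.sum_nonneg fun x _ => hP.1 x
  · simp only [pushforward_eq_sum_filter]
    rw [← hP.2]
    exact Finset.sum_fiberwise _ _ _

theorem pushforward_comp [Fintype Y] (W : X → Y) (W' : Y → Z) (P : X → ℝ) :
    pushforward (W' ∘ W) P = pushforward W' (pushforward W P) := by
  classical
  funext z
  simp only [pushforward, Function.comp]
  have h : ∀ y : Y, (if W' y = z then ∑ x, (if W x = y then P x else 0) else 0)
      = ∑ x, if W x = y then (if W' y = z then P x else 0) else 0 := by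
    intro y
    split_ifs <;> simp
  rw [Finset.sum_congr rfl fun y _ => h y, Finset.sum_comm]
  simp

/-- The image of `l` points has at most `l` points and carries at least their mass. -/
theorem majorizedBy_pushforward [Fintype Y] {P : X → ℝ} (hP : ∀ x, 0 ≤ P x) (W : X → Y) :
    MajorizedBy P (pushforward W P) := by
  classical
  intro l
  refine topSum_le fun A hA => ?_
  refine le_trans ?_ (sum_le_topSum _ (Finset.card_image_le.trans hA) :
    ∑ y ∈ A.image W, pushforward W P y ≤ _)
  rw [← Finset.sum_fiberwise_of_maps_to (g := W) (fun x hx => Finset.mem_image_of_mem W hx)]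
  refine Finset.sum_le_sum fun y _ => ?_
  rw [pushforward_eq_sum_filter]
  exact Finset.sum_le_sum_of_subset_of_nonneg
    (Finset.filter_subset_filter _ (Finset.subset_univ _)) fun x _ _ => hP x

end Pushforward

/-! ### Upper bounds on the fidelity -/

section Fidelity

variable {X Y : Type*} [Fintype X] [Fintype Y]

theorem fidelity_nonneg (Q Q' : Y → ℝ) : 0 ≤ fidelity Q Q' :=
  Finset.sum_nonneg fun _ _ => mul_nonneg (Real.sqrt_nonneg _) (Real.sqrt_nonneg _)

/-- Cauchy–Schwarz on `A` and on its complement; one factor, being at most `1`, is dropped from each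
product. -/
theorem fidelity_le_sqrt_add_sqrt {R Q : Y → ℝ} (hR : R ∈ stdSimplex ℝ Y)
    (hQ : Q ∈ stdSimplex ℝ Y) (A : Finset Y) :
    fidelity R Q ≤ √(∑ y ∈ A, Q y) + √(1 - ∑ y ∈ A, R y) := by
  classical
  have hc : ∑ y ∈ Aᶜ, R y = 1 - ∑ y ∈ A, R y := by
    rw [← hR.2, ← Finset.sum_add_sum_compl A]; ring
  have cs : ∀ B : Finset Y, ∑ y ∈ B, √(R y) * √(Q y) ≤ √(∑ y ∈ B, R y) * √(∑ y ∈ B, Q y) :=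
    fun B => Real.sum_sqrt_mul_sqrt_le B (fun y => hR.1 y) (fun y => hQ.1 y)
  have hs : ∀ {U : Y → ℝ}, U ∈ stdSimplex ℝ Y → ∀ B : Finset Y, √(∑ y ∈ B, U y) ≤ 1 :=
    fun hU B => Real.sqrt_le_one.2 (sum_le_one_of_mem_stdSimplex hU B)
  unfold fidelity
  rw [← Finset.sum_add_sum_compl A, ← hc]
  exact add_le_add
    ((cs A).trans (mul_le_of_le_one_left (Real.sqrt_nonneg _) (hs hR A)))
    ((cs Aᶜ).trans (mul_le_of_le_one_right (Real.sqrt_nonneg _) (hs hQ Aᶜ)))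

theorem fidelity_le_one {R Q : Y → ℝ} (hR : R ∈ stdSimplex ℝ Y) (hQ : Q ∈ stdSimplex ℝ Y) :
    fidelity R Q ≤ 1 := by
  simpa [hR.2, hQ.2] using fidelity_le_sqrt_add_sqrt hR hQ Finset.univ

theorem bddAbove_fidelityMaj_set {X Y : Type*} [Fintype Y] (P : X → ℝ) {Q : Y → ℝ} (hQ : Q ∈ stdSimplex ℝ Y) (N : ℕ) :
    BddAbove {f : ℝ | ∃ P' ∈ stdSimplex ℝ (Bits N), ∃ P'' ∈ stdSimplex ℝ Y,
      MajorizedBy P P' ∧ MajorizedBy P' P'' ∧ f = fidelity P'' Q} := by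
  refine ⟨1, ?_⟩
  rintro _ ⟨P', -, P'', h, -, -, rfl⟩
  exact fidelity_le_one h hQ

theorem fidelity_le_fidelityDet {P : X → ℝ} {Q : Y → ℝ} (hP : P ∈ stdSimplex ℝ X)
    (hQ : Q ∈ stdSimplex ℝ Y) {N : ℕ} (W : X → Bits N) (W' : Bits N → Y) :
    fidelity (pushforward (W' ∘ W) P) Q ≤ fidelityDet P Q N := by
  refine le_csSup ⟨1, ?_⟩ ⟨W, W', rfl⟩
  rintro _ ⟨W, W', rfl⟩
  exact fidelity_le_one (pushforward_mem_stdSimplex hP _) hQ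

theorem fidelityDet_nonneg (P : X → ℝ) (Q : Y → ℝ) (N : ℕ) : 0 ≤ fidelityDet P Q N := by
  refine Real.sSup_nonneg ?_
  rintro _ ⟨W, W', rfl⟩
  exact fidelity_nonneg _ _

theorem fidelityMaj_nonneg (P : X → ℝ) (Q : Y → ℝ) (N : ℕ) : 0 ≤ fidelityMaj P Q N := by
  refine Real.sSup_nonneg ?_
  rintro _ ⟨P', -, P'', -, -, -, rfl⟩
  exact fidelity_nonneg _ _

theorem fidelityDet_le_fidelityMaj {P : X → ℝ} {Q : Y → ℝ} (hP : P ∈ stdSimplex ℝ X)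
    (hQ : Q ∈ stdSimplex ℝ Y) (N : ℕ) : fidelityDet P Q N ≤ fidelityMaj P Q N := by
  refine Real.sSup_le ?_ (fidelityMaj_nonneg _ _ _)
  rintro _ ⟨W, W', rfl⟩
  have hW := pushforward_mem_stdSimplex hP W
  refine le_csSup (bddAbove_fidelityMaj_set P hQ N)
    ⟨_, hW, _, pushforward_mem_stdSimplex hW W', majorizedBy_pushforward hP.1 W,
      majorizedBy_pushforward hW.1 W', ?_⟩
  rw [pushforward_comp]

/-- Take for `A` the `K` heaviest points of `P''`: majorization carries the bound `m` from `P'` over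
to `P''`. With `K = 2 ^ N` and `m = 1` this measures the limit set by the storage, with `m = topSum
P K` the limit set by the source. -/
theorem fidelityMaj_le {P : X → ℝ} {Q : Y → ℝ} (hQ : Q ∈ stdSimplex ℝ Y) (N K : ℕ) {m : ℝ}
    (h : ∀ P' ∈ stdSimplex ℝ (Bits N), MajorizedBy P P' → m ≤ topSum P' K) :
    fidelityMaj P Q N ≤ √(topSum Q K) + √(1 - m) := by
  refine Real.sSup_le ?_ (add_nonneg (Real.sqrt_nonneg _) (Real.sqrt_nonneg _))
  rintro _ ⟨P', hP', P'', hP'', h1, h2, rfl⟩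
  obtain ⟨A, hA, hAs⟩ := exists_sum_eq_topSum P'' K
  refine (fidelity_le_sqrt_add_sqrt hP'' hQ A).trans (add_le_add
    (Real.sqrt_le_sqrt (sum_le_topSum Q hA)) (Real.sqrt_le_sqrt (sub_le_sub_left ?_ _)))
  rw [hAs]
  exact (h P' hP' h1).trans (h2 K)

theorem fidelityMaj_le_sqrt_topSum {P : X → ℝ} {Q : Y → ℝ} (hQ : Q ∈ stdSimplex ℝ Y) (N : ℕ) :
    fidelityMaj P Q N ≤ √(topSum Q (2 ^ N)) := by
  refine (fidelityMaj_le hQ N (2 ^ N) (m := 1) fun P' hP' _ => ?_).trans (by simp)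
  rw [← hP'.2]
  exact sum_le_topSum _ (by simp)

theorem fidelityMaj_le_add_sqrt_topSum {P : X → ℝ} {Q : Y → ℝ} (hQ : Q ∈ stdSimplex ℝ Y)
    (N K : ℕ) : fidelityMaj P Q N ≤ √(topSum Q K) + √(1 - topSum P K) :=
  fidelityMaj_le hQ N K fun _ _ h => h K

theorem fidelityDet_le_maxFidelity {P : X → ℝ} {Q : Y → ℝ} (hP : P ∈ stdSimplex ℝ X)
    (hQ : Q ∈ stdSimplex ℝ Y) (i : ConvType) (N : ℕ) :
    fidelityDet P Q N ≤ maxFidelity i P Q N := by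
  cases i
  · exact le_rfl
  · exact fidelityDet_le_fidelityMaj hP hQ N

theorem maxFidelity_le_fidelityMaj {P : X → ℝ} {Q : Y → ℝ} (hP : P ∈ stdSimplex ℝ X)
    (hQ : Q ∈ stdSimplex ℝ Y) (i : ConvType) (N : ℕ) :
    maxFidelity i P Q N ≤ fidelityMaj P Q N := by
  cases i
  · exact fidelityDet_le_fidelityMaj hP hQ N
  · exact le_rfl

theorem maxFidelity_nonneg (i : ConvType) (P : X → ℝ) (Q : Y → ℝ) (N : ℕ) :
    0 ≤ maxFidelity i P Q N := by
  cases i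
  · exact fidelityDet_nonneg _ _ _
  · exact fidelityMaj_nonneg _ _ _

end Fidelity

/-! ### Achievability by binning -/

section Binning

variable {X Y : Type*}

/-- A family of masses of size at most `ε` can be distributed greedily over bins of prescribed
sizes, so that each bin is filled up to `ε`. -/
theorem exists_binning [DecidableEq Y] [Nonempty Y] {p : X → ℝ}
    {ε : ℝ} (hε₀ : 0 ≤ ε) {r : Y → ℝ} (A : Finset Y) (hr : ∀ y ∈ A, 0 ≤ r y) :
    ∀ B : Finset X, (∀ x ∈ B, 0 ≤ p x) → (∀ x ∈ B, p x ≤ ε) →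
      ∑ y ∈ A, r y ≤ ∑ x ∈ B, p x →
      ∃ f : X → Y, ∀ y ∈ A, r y - ε ≤ ∑ x ∈ B with f x = y, p x := by
  classical
  induction A using Finset.induction_on with
  | empty => exact fun B _ _ _ => ⟨fun _ => Classical.arbitrary Y, by simp⟩
  | insert y₀ A hy₀ ih =>
    intro B hp hε h
    rw [Finset.sum_insert hy₀] at h
    have hr₀ := hr y₀ (Finset.mem_insert_self _ _)
    have hr' : ∀ y ∈ A, 0 ≤ r y := fun y hy => hr y (Finset.mem_insert_of_mem hy)
    -- A subset of maximal cardinality that still fits into the first bin: any further atom would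
    -- overflow it, so it is filled up to one atom, hence up to `ε`.
    obtain ⟨C, hC, hmax⟩ := Finset.exists_max_image
      (B.powerset.filter fun C => ∑ x ∈ C, p x ≤ r y₀) Finset.card ⟨∅, by simp [hr₀]⟩
    simp only [Finset.mem_filter, Finset.mem_powerset, and_imp] at hC hmax
    obtain ⟨hCB, hCr⟩ := hC
    have hCl : r y₀ - ε ≤ ∑ x ∈ C, p x := by
      by_cases hBC : B ⊆ C
      -- No atom is left to add, but then all of `B` lies in this bin, and its mass is at least the
      -- sum of all bin sizes.
      · obtain rfl : C = B := hCB.antisymm hBC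
        linarith [Finset.sum_nonneg hr']
      · obtain ⟨x, hxB, hxC⟩ := Finset.not_subset.1 hBC
        by_contra! hlt
        have hs := Finset.sum_insert hxC (f := p)
        have := hmax (insert x C) (Finset.insert_subset hxB hCB) (by linarith [hε x hxB])
        rw [Finset.card_insert_of_notMem hxC] at this
        omega
    have hsd := Finset.sum_sdiff hCB (f := p)
    obtain ⟨f, hf⟩ := ih hr' (B \ C) (fun x hx => hp x (Finset.sdiff_subset hx))
      (fun x hx => hε x (Finset.sdiff_subset hx)) (by linarith)
    refine ⟨fun x => if x ∈ C then y₀ else f x, fun y hy => ?_⟩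
    rcases Finset.mem_insert.1 hy with rfl | hy
    · refine hCl.trans (Finset.sum_le_sum_of_subset_of_nonneg (fun x hx => ?_)
        fun x hx _ => hp x (Finset.mem_of_mem_filter _ hx))
      simp [hx, hCB hx]
    · refine (hf y hy).trans (Finset.sum_le_sum_of_subset_of_nonneg (fun x hx => ?_)
        fun x hx _ => hp x (Finset.mem_of_mem_filter _ hx))
      simp only [Finset.mem_filter, Finset.mem_sdiff] at hx ⊢
      simp [hx.1.1, hx.1.2, hx.2]

variable [Fintype X] [Fintype Y]

open Classical in
/-- A map into a set `A` of at most `2 ^ N` points is a deterministic conversion through `N`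
bits. -/
theorem fidelity_le_fidelityDet_of_mapsTo {P : X → ℝ} {Q : Y → ℝ} (hP : P ∈ stdSimplex ℝ X)
    (hQ : Q ∈ stdSimplex ℝ Y) {N : ℕ} {A : Finset Y} (hA : A.card ≤ 2 ^ N) {f : X → Y}
    (hf : ∀ x, f x ∈ A) : fidelity (pushforward f P) Q ≤ fidelityDet P Q N := by
  obtain ⟨x₀⟩ : Nonempty X := by
    by_contra h
    rw [not_nonempty_iff] at h
    simpa using hP.2
  obtain ⟨e⟩ : Nonempty (A ↪ Bits N) :=
    Function.Embedding.nonempty_of_card_le (by simpa using hA)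
  have : Nonempty A := ⟨⟨f x₀, hf x₀⟩⟩
  have h := fidelity_le_fidelityDet hP hQ (fun x => e ⟨f x, hf x⟩)
    (fun b => (Function.invFun (⇑e) b).1)
  convert h using 2
  congr 1
  funext x
  simp [Function.leftInverse_invFun e.injective _]

theorem card_le_of_forall_le {Q : Y → ℝ} (hQ : Q ∈ stdSimplex ℝ Y) {A : Finset Y} {θ : ℝ}
    (h : ∀ y ∈ A, θ ≤ Q y) : A.card * θ ≤ 1 := by
  rw [← nsmul_eq_mul]
  exact (Finset.card_nsmul_le_sum A Q θ h).trans (sum_le_one_of_mem_stdSimplex hQ A)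

/-- The light atoms of `P`, of total mass `m`, are packed into bins of sizes proportional to `Q` on
its heavy part `A`, of mass `q`. Each bin loses at most `ε ≤ δ * Q y`, so its mass is still at least
`Q y / q * (m - δ)`, and summing over `A` yields the bound. As heavy points have mass at least `ε =
2 ^ (-N)`, they fit into the storage. -/
theorem sqrt_le_fidelityDet {P : X → ℝ} {Q : Y → ℝ} (hP : P ∈ stdSimplex ℝ X)
    (hQ : Q ∈ stdSimplex ℝ Y) (N : ℕ) {δ : ℝ} (hδ : 0 < δ) (hδ₁ : δ ≤ 1) {ε : ℝ}
    (hε : ε = (2 ^ N)⁻¹) :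
    √((∑ y with ε ≤ δ * Q y, Q y) * (∑ x with P x ≤ ε, P x - δ)) ≤ fidelityDet P Q N := by
  classical
  set A : Finset Y := {y | ε ≤ δ * Q y} with hAdef
  set B : Finset X := {x | P x ≤ ε} with hBdef
  set q := ∑ y ∈ A, Q y with hq
  set m := ∑ x ∈ B, P x with hm
  have hε₀ : 0 < ε := by rw [hε]; positivity
  have hAQ : ∀ y ∈ A, ε ≤ δ * Q y := fun y hy => (Finset.mem_filter.1 hy).2
  have hq₀ : 0 ≤ q := Finset.sum_nonneg fun y _ => hQ.1 y
  have hm₀ : 0 ≤ m := Finset.sum_nonneg fun x _ => hP.1 x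
  have hq₁ : q ≤ 1 := sum_le_one_of_mem_stdSimplex hQ A
  rcases le_or_gt (q * (m - δ)) 0 with hle | hpos
  · rw [Real.sqrt_eq_zero_of_nonpos hle]
    exact fidelityDet_nonneg _ _ _
  have hq_pos : 0 < q := lt_of_le_of_ne hq₀ (by rintro h; simp [← h] at hpos)
  have hβ : 0 < m - δ := pos_of_mul_pos_right hpos hq₀
  obtain ⟨y₀, hy₀⟩ : A.Nonempty := by
    by_contra h
    rw [Finset.not_nonempty_iff_eq_empty] at h
    simp [hq, h] at hq_pos
  have hcard : A.card ≤ 2 ^ N := by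
    have h1 : (A.card : ℝ) * ε ≤ 1 := card_le_of_forall_le hQ fun y hy =>
      (hAQ y hy).trans (mul_le_of_le_one_left (hQ.1 y) hδ₁)
    rw [hε, ← div_eq_mul_inv, div_le_one (by positivity)] at h1
    exact_mod_cast h1
  have : Nonempty Y := ⟨y₀⟩
  obtain ⟨g, hg⟩ := exists_binning (p := P) hε₀.le (r := fun y => Q y / q * m) A
    (fun y _ => mul_nonneg (div_nonneg (hQ.1 y) hq₀) hm₀) B (fun x _ => hP.1 x)
    (fun x hx => (Finset.mem_filter.1 hx).2)
    (by rw [← Finset.sum_mul, ← Finset.sum_div, ← hq, div_self hq_pos.ne', one_mul])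
  -- Everything sent outside `A` is redirected to `y₀`; this only adds mass to a bin.
  let f : X → Y := fun x => if g x ∈ A then g x else y₀
  have hf : ∀ x, f x ∈ A := fun x => by simp only [f]; split_ifs <;> assumption
  refine le_trans ?_ (fidelity_le_fidelityDet_of_mapsTo hP hQ hcard hf)
  have hlow : ∀ y ∈ A, Q y / q * (m - δ) ≤ pushforward f P y := fun y hy => by
    have h1 : ε ≤ Q y / q * δ := (hAQ y hy).trans (by
      rw [mul_comm]
      exact mul_le_mul_of_nonneg_right (le_div_self (hQ.1 y) hq_pos hq₁) hδ.le)
    have h2 : ∑ x ∈ B with g x = y, P x ≤ pushforward f P y := by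
      rw [pushforward_eq_sum_filter]
      refine Finset.sum_le_sum_of_subset_of_nonneg (fun x hx => ?_) fun x _ _ => hP.1 x
      have hx := (Finset.mem_filter.1 hx).2
      simp [f, hx, hy]
    linarith [hg y hy]
  have hnn : 0 ≤ (m - δ) / q := div_nonneg hβ.le hq₀
  calc √(q * (m - δ)) = q * √((m - δ) / q) := by
        rw [← Real.sqrt_sq hq₀, ← Real.sqrt_mul (sq_nonneg q), Real.sqrt_sq hq₀]
        congr 1
        field_simp
    _ = ∑ y ∈ A, √(Q y / q * (m - δ)) * √(Q y) := by
        rw [hq, Finset.sum_mul, ← hq]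
        refine Finset.sum_congr rfl fun y _ => ?_
        rw [div_mul_eq_mul_div, mul_div_assoc, Real.sqrt_mul (hQ.1 y), mul_right_comm,
          Real.mul_self_sqrt (hQ.1 y)]
    _ ≤ ∑ y ∈ A, √(pushforward f P y) * √(Q y) := Finset.sum_le_sum fun y hy =>
        mul_le_mul_of_nonneg_right (Real.sqrt_le_sqrt (hlow y hy)) (Real.sqrt_nonneg _)
    _ ≤ fidelity (pushforward f P) Q :=
        Finset.sum_le_sum_of_subset_of_nonneg (Finset.subset_univ _) fun y _ _ =>
          mul_nonneg (Real.sqrt_nonneg _) (Real.sqrt_nonneg _)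

end Binning

/-! ### One-shot bounds in terms of the information content -/

section InfoCDF

variable {X : Type*} [Fintype X]

/-- The distribution function of the information content `-log₂ Pⁿ` under `Pⁿ`. -/
noncomputable def infoCDF (P : X → ℝ) (n : ℕ) (a : ℝ) : ℝ :=
  ∑ x : Fin n → X with ∑ k, -Real.logb 2 (P (x k)) ≤ a, iid P n x

variable {P : X → ℝ}

theorem iid_mem_stdSimplex (hP : P ∈ stdSimplex ℝ X) (n : ℕ) :
    iid P n ∈ stdSimplex ℝ (Fin n → X) := by
  classical
  refine ⟨fun x => Finset.prod_nonneg fun k _ => hP.1 _, ?_⟩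
  have := Finset.prod_univ_sum (fun _ : Fin n => (Finset.univ : Finset X)) fun _ x => P x
  simpa [iid, hP.2] using this.symm

theorem iid_eq_rpow (hP : P ∈ stdSimplex ℝ X) {n : ℕ} {x : Fin n → X} (h : iid P n x ≠ 0) :
    iid P n x = 2 ^ (-∑ k, -Real.logb 2 (P (x k))) := by
  have hpos : ∀ k, 0 < P (x k) := fun k =>
    lt_of_le_of_ne (hP.1 _) (Ne.symm (Finset.prod_ne_zero_iff.1 h k (Finset.mem_univ k)))
  rw [Finset.sum_neg_distrib, neg_neg, Real.rpow_sum_of_pos two_pos]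
  exact Finset.prod_congr rfl fun k _ => (Real.rpow_logb two_pos (by norm_num) (hpos k)).symm

theorem infoCDF_nonneg (hP : P ∈ stdSimplex ℝ X) (n : ℕ) (a : ℝ) : 0 ≤ infoCDF P n a :=
  Finset.sum_nonneg fun x _ => (iid_mem_stdSimplex hP n).1 x

theorem infoCDF_le_one (hP : P ∈ stdSimplex ℝ X) (n : ℕ) (a : ℝ) : infoCDF P n a ≤ 1 :=
  sum_le_one_of_mem_stdSimplex (iid_mem_stdSimplex hP n) _

theorem infoCDF_mono (hP : P ∈ stdSimplex ℝ X) (n : ℕ) : Monotone (infoCDF P n) := fun _ _ h =>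
  Finset.sum_le_sum_of_subset_of_nonneg
    (Finset.monotone_filter_right _ fun _ _ hx => le_trans hx h)
    fun x _ _ => (iid_mem_stdSimplex hP n).1 x

theorem infoCDF_eq_sum_filter (hP : P ∈ stdSimplex ℝ X) (n : ℕ) (a : ℝ) :
    infoCDF P n a = ∑ x with (2 : ℝ) ^ (-a) ≤ iid P n x, iid P n x := by
  rw [infoCDF, Finset.sum_filter, Finset.sum_filter]
  refine Finset.sum_congr rfl fun x _ => ?_
  -- Since `Real.logb 2 0 = 0`, the two filters may differ on null words, which contribute nothing.
  by_cases h : iid P n x = 0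
  · simp [h]
  · congr 1
    rw [iid_eq_rpow hP h, Real.rpow_le_rpow_left_iff one_lt_two, neg_le_neg_iff]

theorem one_sub_infoCDF_le (hP : P ∈ stdSimplex ℝ X) (n : ℕ) (a : ℝ) :
    1 - infoCDF P n a ≤ ∑ x with iid P n x ≤ (2 : ℝ) ^ (-a), iid P n x := by
  rw [infoCDF_eq_sum_filter hP, sub_le_iff_le_add, ← (iid_mem_stdSimplex hP n).2,
    ← Finset.sum_filter_add_sum_filter_not _ (fun x => iid P n x ≤ (2 : ℝ) ^ (-a))]
  refine add_le_add_right (Finset.sum_le_sum_of_subset_of_nonneg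
    (Finset.monotone_filter_right _ fun x _ hx => (not_le.1 hx).le)
    fun x _ _ => (iid_mem_stdSimplex hP n).1 x) _

/-- At most `2 ^ k` words can have probability at least `2 ^ (-k)`. -/
theorem infoCDF_le_topSum (hP : P ∈ stdSimplex ℝ X) (n k : ℕ) :
    infoCDF P n k ≤ topSum (iid P n) (2 ^ k) := by
  rw [infoCDF_eq_sum_filter hP]
  refine sum_le_topSum _ ?_
  have h := card_le_of_forall_le (iid_mem_stdSimplex hP n)
    (A := {x | (2 : ℝ) ^ (-(k : ℝ)) ≤ iid P n x}) fun x hx => (Finset.mem_filter.1 hx).2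
  have h2 : (2 : ℝ) ^ (-(k : ℝ)) = (2 ^ k)⁻¹ := by
    rw [Real.rpow_neg two_pos.le, Real.rpow_natCast]
  rw [mul_comm, h2, inv_mul_le_iff₀ (by positivity), mul_one, ← h2] at h
  exact_mod_cast h

/-- Among `2 ^ k` words, those of probability below `2 ^ (-(k + c))` contribute at most `2 ^ (-c)`
in total. -/
theorem topSum_le_infoCDF_add (hP : P ∈ stdSimplex ℝ X) (n k : ℕ) (c : ℝ) :
    topSum (iid P n) (2 ^ k) ≤ infoCDF P n (k + c) + 2 ^ (-c) := by
  refine topSum_le fun A hA => ?_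
  rw [infoCDF_eq_sum_filter hP,
    ← Finset.sum_filter_add_sum_filter_not A (fun x => (2 : ℝ) ^ (-(k + c)) ≤ iid P n x)]
  refine add_le_add (Finset.sum_le_sum_of_subset_of_nonneg
    (Finset.filter_subset_filter _ (Finset.subset_univ _))
    fun x _ _ => (iid_mem_stdSimplex hP n).1 x) ?_
  refine (Finset.sum_le_card_nsmul _ _ ((2 : ℝ) ^ (-(k + c)))
    fun x hx => (not_le.1 (Finset.mem_filter.1 hx).2).le).trans ?_
  have h1 : (((A.filter fun x => ¬ (2 : ℝ) ^ (-(k + c)) ≤ iid P n x).card : ℕ) : ℝ) ≤ 2 ^ k := by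
    exact_mod_cast (Finset.card_filter_le _ _).trans hA
  have h2 : (2 : ℝ) ^ (-(k + c)) = (2 ^ k)⁻¹ * 2 ^ (-c) := by
    rw [neg_add, Real.rpow_add two_pos, Real.rpow_neg two_pos.le, Real.rpow_natCast]
  rw [nsmul_eq_mul]
  refine (mul_le_mul_of_nonneg_right h1 (by positivity)).trans ?_
  rw [h2, ← mul_assoc, mul_inv_cancel₀ (by positivity), one_mul]

variable {Y : Type*} [Fintype Y] {Q : Y → ℝ}

theorem maxFidelity_iid_le_sqrt (hP : P ∈ stdSimplex ℝ X) (hQ : Q ∈ stdSimplex ℝ Y)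
    (i : ConvType) (n T N : ℕ) (c : ℝ) :
    maxFidelity i (iid P n) (iid Q T) N ≤ √(infoCDF Q T (N + c) + 2 ^ (-c)) :=
  (maxFidelity_le_fidelityMaj (iid_mem_stdSimplex hP n) (iid_mem_stdSimplex hQ T) i N).trans
    ((fidelityMaj_le_sqrt_topSum (iid_mem_stdSimplex hQ T) N).trans
      (Real.sqrt_le_sqrt (topSum_le_infoCDF_add hQ T N c)))

theorem maxFidelity_iid_le_add_sqrt (hP : P ∈ stdSimplex ℝ X) (hQ : Q ∈ stdSimplex ℝ Y)
    (i : ConvType) (n T N k : ℕ) (c : ℝ) :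
    maxFidelity i (iid P n) (iid Q T) N ≤
      √(infoCDF Q T (k + c) + 2 ^ (-c)) + √(1 - infoCDF P n k) :=
  (maxFidelity_le_fidelityMaj (iid_mem_stdSimplex hP n) (iid_mem_stdSimplex hQ T) i N).trans
    ((fidelityMaj_le_add_sqrt_topSum (iid_mem_stdSimplex hQ T) N (2 ^ k)).trans
      (add_le_add (Real.sqrt_le_sqrt (topSum_le_infoCDF_add hQ T k c))
        (Real.sqrt_le_sqrt (sub_le_sub_left (infoCDF_le_topSum hP n k) _))))

/-- Binning with `δ = 2 ^ (-c)`: the threshold `2 ^ (-N) ≤ δ * Q y` costs `c` bits of information.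
-/
theorem sqrt_le_maxFidelity_iid (hP : P ∈ stdSimplex ℝ X) (hQ : Q ∈ stdSimplex ℝ Y)
    (i : ConvType) (n T N : ℕ) {c : ℝ} (hc : 0 ≤ c) :
    √(infoCDF Q T (N - c) * (1 - infoCDF P n N - 2 ^ (-c))) ≤
      maxFidelity i (iid P n) (iid Q T) N := by
  have hPn := iid_mem_stdSimplex hP n
  have hQT := iid_mem_stdSimplex hQ T
  refine le_trans (Real.sqrt_le_sqrt ?_) ((sqrt_le_fidelityDet hPn hQT N (δ := 2 ^ (-c))
    (ε := 2 ^ (-(N : ℝ))) (by positivity) (Real.rpow_le_one_of_one_le_of_nonpos one_le_two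
      (by linarith)) (by rw [Real.rpow_neg two_pos.le, Real.rpow_natCast])).trans
    (fidelityDet_le_maxFidelity hPn hQT i N))
  have h : ∀ y, (2 : ℝ) ^ (-(N : ℝ)) ≤ 2 ^ (-c) * iid Q T y ↔
      (2 : ℝ) ^ (-((N : ℝ) - c)) ≤ iid Q T y := fun y => by
    have : (2 : ℝ) ^ (-(N : ℝ)) = 2 ^ (-c) * 2 ^ (-((N : ℝ) - c)) := by
      rw [← Real.rpow_add two_pos]; congr 1; ring
    rw [this, mul_le_mul_iff_right₀ (by positivity)]
  simp only [h]
  rw [← infoCDF_eq_sum_filter hQ]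
  exact mul_le_mul_of_nonneg_left (sub_le_sub_right (one_sub_infoCDF_le hP n N) _)
    (infoCDF_nonneg hQ _ _)

end InfoCDF

end RNC

namespace RNC

open MeasureTheory ProbabilityTheory Topology

/-! ### The central limit theorem for the information content -/

section Law

variable {X : Type*} [Fintype X] [MeasurableSpace X] [MeasurableSingletonClass X]

/-- A distribution on a finite set as a measure. -/
noncomputable def toMeasure {P : X → ℝ} (hP : P ∈ stdSimplex ℝ X) : Measure X :=
  (PMF.ofFintype (fun x => ENNReal.ofReal (P x)) (by
    rw [← ENNReal.ofReal_sum_of_nonneg fun x _ => hP.1 x, hP.2, ENNReal.ofReal_one])).toMeasure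

instance {P : X → ℝ} (hP : P ∈ stdSimplex ℝ X) : IsProbabilityMeasure (toMeasure hP) := by
  unfold toMeasure; infer_instance

variable {P : X → ℝ} (hP : P ∈ stdSimplex ℝ X)

theorem toMeasure_real_singleton (x : X) : (toMeasure hP).real {x} = P x := by
  rw [toMeasure, measureReal_def, PMF.toMeasure_apply_singleton _ _ (measurableSet_singleton x)]
  simp [hP.1 x]

theorem integral_toMeasure (f : X → ℝ) : ∫ x, f x ∂toMeasure hP = ∑ x, P x * f x := by
  rw [toMeasure, PMF.integral_eq_sum]
  simp [hP.1]

theorem pi_toMeasure_real_singleton (n : ℕ) (x : Fin n → X) :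
    (Measure.pi fun _ : Fin n => toMeasure hP).real {x} = iid P n x := by
  simp [measureReal_def, Measure.pi_singleton, ENNReal.toReal_prod, iid,
    ← toMeasure_real_singleton hP]

/-- The infinite product puts all block lengths on one probability space, where the central limit
theorem applies. -/
theorem infoCDF_eq_measureReal (n : ℕ) (a : ℝ) :
    infoCDF P n a = (Measure.infinitePi fun _ : ℕ => toMeasure hP).real
      {ω | ∑ k ∈ Finset.range n, -Real.logb 2 (P (ω k)) ≤ a} := by
  have hmap := Measure.map_infinitePi_infinitePi_of_inj (P := fun _ : ℕ => toMeasure hP)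
    (Fin.val_injective (n := n))
  rw [Measure.infinitePi_eq_pi (ι := Fin n)] at hmap
  rw [infoCDF, ← Finset.sum_congr rfl fun x _ => pi_toMeasure_real_singleton hP n x,
    sum_measureReal_singleton, ← hmap, map_measureReal_apply (by fun_prop)
      (Set.toFinite _).measurableSet]
  congr 1
  ext ω
  simp [Finset.sum_range]

end Law

variable {X : Type*} [Fintype X] {P : X → ℝ}

/-- Variance zero is allowed, since the source may be uniform on its support; the limit is then a
Dirac mass, and `hx` excludes only its jump. -/
theorem tendsto_infoCDF_of_gaussianReal (hP : P ∈ stdSimplex ℝ X) {x : ℝ}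
    (hx : gaussianReal 0 (varentropy P).toNNReal {x} = 0) :
    Tendsto (fun n : ℕ => infoCDF P n (n * entropy P + x * √n)) atTop
      (𝓝 (cdf (gaussianReal 0 (varentropy P).toNNReal) x)) := by
  let _ : MeasurableSpace X := ⊤
  have hsc : MeasurableSingletonClass X := ⟨fun _ => trivial⟩
  set μ := Measure.infinitePi fun _ : ℕ => toMeasure hP with hμ
  let J : X → ℝ := fun x => -Real.logb 2 (P x)
  have hJ : Measurable J := measurable_from_top
  have hmp : ∀ k : ℕ, MeasurePreserving (fun ω : ℕ → X => ω k) μ (toMeasure hP) := fun k =>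
    ⟨by fun_prop, Measure.infinitePi_map_eval _ k⟩
  have hid : ∀ k : ℕ, IdentDistrib (fun ω : ℕ → X => J (ω k)) J μ (toMeasure hP) := fun k =>
    ⟨(hJ.comp (hmp k).measurable).aemeasurable, hJ.aemeasurable, by
      rw [← (hmp k).map_eq, Measure.map_map hJ (hmp k).measurable]; rfl⟩
  have hmean : ∫ x, J x ∂toMeasure hP = entropy P := by
    rw [integral_toMeasure]; simp [J, entropy]
  have hvar : Var[J; toMeasure hP] = varentropy P := by
    rw [variance_eq_integral hJ.aemeasurable, hmean, integral_toMeasure]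
    rfl
  have hLp : MemLp J 2 (toMeasure hP) := MemLp.of_discrete
  have hind : iIndepFun (fun (k : ℕ) (ω : ℕ → X) => J (ω k)) μ :=
    iIndepFun_infinitePi (X := fun _ => J) fun _ => hJ
  have hclt := tendstoInDistribution_inv_sqrt_mul_sum_sub
    (X := fun (k : ℕ) (ω : ℕ → X) => J (ω k)) (P := μ) (Y := id)
    (P' := gaussianReal 0 (varentropy P).toNNReal)
    (by rw [(hid 0).variance_eq, hvar]; exact HasLaw.id)
    ((hid 0).memLp_iff.2 hLp) hind (fun k => (hid k).trans (hid 0).symm)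
  have hlim := ProbabilityMeasure.tendsto_measure_of_null_frontier_of_tendsto' hclt.tendsto
    (E := Set.Iic x) (by simpa using hx)
  simp only [ProbabilityMeasure.coe_mk, Measure.map_id] at hlim
  rw [cdf_eq_real]
  refine ((ENNReal.tendsto_toReal (measure_ne_top _ _)).comp hlim).congr' ?_
  filter_upwards [eventually_gt_atTop 0] with n hn
  have hn' : 0 < √(n : ℝ) := Real.sqrt_pos.2 (by exact_mod_cast hn)
  rw [Function.comp_apply, Measure.map_apply_of_aemeasurable (hclt.forall_aemeasurable n)
    measurableSet_Iic, infoCDF_eq_measureReal hP, measureReal_def]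
  congr 2
  ext ω
  rw [(hid 0).integral_eq, hmean]
  simp only [Set.mem_preimage, Set.mem_Iic, Set.mem_ofPred_eq, J]
  rw [inv_mul_le_iff₀ hn', sub_le_iff_le_add, mul_comm, add_comm]

theorem eventually_lt_infoCDF (hP : P ∈ stdSimplex ℝ X) {b c : ℝ}
    (hb : gaussianReal 0 (varentropy P).toNNReal {b} = 0)
    (hc : c < cdf (gaussianReal 0 (varentropy P).toNNReal) b) {ι : Type*} {l : Filter ι}
    {T : ι → ℕ} (hT : Tendsto T l atTop) {a : ι → ℝ}
    (ha : ∀ᶠ i in l, b ≤ (a i - T i * entropy P) / √(T i)) :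
    ∀ᶠ i in l, c < infoCDF P (T i) (a i) := by
  filter_upwards [ha, hT.eventually_gt_atTop 0,
    hT.eventually ((tendsto_infoCDF_of_gaussianReal hP hb).eventually_const_lt hc)] with i hi hT₀ h
  refine h.trans_le (infoCDF_mono hP _ ?_)
  rw [le_div_iff₀ (Real.sqrt_pos.2 (by exact_mod_cast hT₀))] at hi
  linarith

theorem eventually_infoCDF_lt (hP : P ∈ stdSimplex ℝ X) {b c : ℝ}
    (hb : gaussianReal 0 (varentropy P).toNNReal {b} = 0)
    (hc : cdf (gaussianReal 0 (varentropy P).toNNReal) b < c) {ι : Type*} {l : Filter ι}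
    {T : ι → ℕ} (hT : Tendsto T l atTop) {a : ι → ℝ}
    (ha : ∀ᶠ i in l, (a i - T i * entropy P) / √(T i) ≤ b) :
    ∀ᶠ i in l, infoCDF P (T i) (a i) < c := by
  filter_upwards [ha, hT.eventually_gt_atTop 0,
    hT.eventually ((tendsto_infoCDF_of_gaussianReal hP hb).eventually_lt_const hc)] with i hi hT₀ h
  refine (infoCDF_mono hP _ ?_).trans_lt h
  rw [div_le_iff₀ (Real.sqrt_pos.2 (by exact_mod_cast hT₀))] at hi
  linarith

theorem gaussianReal_singleton_eq_zero (v : NNReal) {b : ℝ} (hb : b ≠ 0) :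
    gaussianReal 0 v {b} = 0 := by
  by_cases hv : v = 0
  · subst hv
    simp [gaussianReal_zero_var, hb.symm]
  · have := nullSingletonClass_gaussianReal (μ := 0) hv
    exact measure_singleton b

theorem tendsto_infoCDF_one (hP : P ∈ stdSimplex ℝ X) {ι : Type*} {l : Filter ι} {T : ι → ℕ}
    (hT : Tendsto T l atTop) {a : ι → ℝ}
    (ha : Tendsto (fun i => (a i - T i * entropy P) / √(T i)) l atTop) :
    Tendsto (fun i => infoCDF P (T i) (a i)) l (𝓝 1) := by
  refine tendsto_order.2 ⟨fun c hc => ?_, fun c hc => Eventually.of_forall fun i =>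
    (infoCDF_le_one hP _ _).trans_lt hc⟩
  -- Requiring `b ≠ 0` avoids the atom of the limit law in the case of variance zero.
  obtain ⟨b, hb, hb₀⟩ := (((tendsto_cdf_atTop _).eventually_const_lt hc).and
    (eventually_ne_atTop 0)).exists
  exact eventually_lt_infoCDF hP (gaussianReal_singleton_eq_zero _ hb₀) hb hT
    (ha.eventually_ge_atTop b)

theorem tendsto_infoCDF_zero (hP : P ∈ stdSimplex ℝ X) {ι : Type*} {l : Filter ι} {T : ι → ℕ}
    (hT : Tendsto T l atTop) {a : ι → ℝ}
    (ha : Tendsto (fun i => (a i - T i * entropy P) / √(T i)) l atBot) :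
    Tendsto (fun i => infoCDF P (T i) (a i)) l (𝓝 0) := by
  refine tendsto_order.2 ⟨fun c hc => Eventually.of_forall fun i =>
    hc.trans_le (infoCDF_nonneg hP _ _), fun c hc => ?_⟩
  obtain ⟨b, hb, hb₀⟩ := (((tendsto_cdf_atBot _).eventually_lt_const hc).and
    (eventually_ne_atBot 0)).exists
  exact eventually_infoCDF_lt hP (gaussianReal_singleton_eq_zero _ hb₀) hb hT
    (ha.eventually_le_atBot b)

theorem continuous_cdf (μ : Measure ℝ) [IsProbabilityMeasure μ] [NullSingletonClass μ] :
    Continuous (cdf μ) := by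
  refine continuous_iff_continuousAt.2 fun x => ?_
  rw [(monotone_cdf μ).continuousAt_iff_leftLim_eq_rightLim, StieltjesFunction.rightLim_eq]
  have h := StieltjesFunction.measure_singleton (cdf μ) x
  rw [measure_cdf, measure_singleton, eq_comm, ENNReal.ofReal_eq_zero] at h
  exact le_antisymm ((monotone_cdf μ).leftLim_le le_rfl) (by linarith)

theorem continuous_cdf_gaussianReal {v : NNReal} (hv : v ≠ 0) :
    Continuous (cdf (gaussianReal 0 v)) :=
  have := nullSingletonClass_gaussianReal (μ := 0) hv
  continuous_cdf _

theorem cdf_gaussianReal_eq_stdNormalCDF {v : NNReal} (hv : v ≠ 0) (x : ℝ) :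
    cdf (gaussianReal 0 v) x = stdNormalCDF (x / √v) := by
  have hs : 0 < √(v : ℝ) := Real.sqrt_pos.2 (lt_of_le_of_ne v.2 (by exact_mod_cast hv.symm))
  have h := gaussianReal_map_const_mul (μ := 0) (v := 1) (√v)
  have h1 : NNReal.mk (√(v : ℝ) ^ 2) (sq_nonneg _) * 1 = v := by
    ext; simp
  rw [mul_zero, h1] at h
  rw [stdNormalCDF, cdf_eq_real, cdf_eq_real, ← h, map_measureReal_apply (by fun_prop)
    measurableSet_Iic]
  congr 1
  ext y
  simp [le_div_iff₀ hs, mul_comm]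

theorem continuous_stdNormalCDF : Continuous stdNormalCDF :=
  continuous_cdf_gaussianReal one_ne_zero

theorem strictMono_stdNormalCDF : StrictMono stdNormalCDF := by
  intro x y hxy
  have hpos : 0 < (gaussianReal 0 1).real (Set.Ioc x y) := by
    refine ENNReal.toReal_pos (fun h => ?_) (measure_ne_top _ _)
    have := gaussianReal_absolutelyContinuous' 0 one_ne_zero h
    simp only [Real.volume_Ioc, ENNReal.ofReal_eq_zero] at this
    linarith
  have h := measureReal_union (μ := gaussianReal 0 1) (Set.Iic_disjoint_Ioc (le_refl x) (c := y))
    measurableSet_Ioc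
  rw [Set.Iic_union_Ioc_eq_Iic hxy.le] at h
  rw [stdNormalCDF, stdNormalCDF, cdf_eq_real, cdf_eq_real, h]
  linarith

theorem stdNormalCDF_nonneg (x : ℝ) : 0 ≤ stdNormalCDF x := cdf_nonneg _ _

theorem stdNormalCDF_stdNormalInv {u : ℝ} (hu : u ∈ Set.Ioo (0 : ℝ) 1) :
    stdNormalCDF (stdNormalInv u) = u :=
  Function.invFun_eq (mem_range_of_exists_le_of_exists_ge continuous_stdNormalCDF
    (((tendsto_cdf_atBot _).eventually_le_const hu.1).exists)
    (((tendsto_cdf_atTop _).eventually_const_le hu.2).exists))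

/-- Monotonicity in the threshold lets the moving argument be squeezed between fixed levels `b` on
either side of `x`; continuity of the limit closes the gap. -/
theorem tendsto_infoCDF (hP : P ∈ stdSimplex ℝ X) (hV : 0 < varentropy P) {ι : Type*}
    {l : Filter ι} {T : ι → ℕ} (hT : Tendsto T l atTop) {a : ι → ℝ} {x : ℝ}
    (ha : Tendsto (fun i => (a i - T i * entropy P) / √(T i)) l (𝓝 x)) :
    Tendsto (fun i => infoCDF P (T i) (a i)) l (𝓝 (stdNormalCDF (x / √(varentropy P)))) := by
  have hv : (varentropy P).toNNReal ≠ 0 := by simpa using hV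
  have hc := continuous_cdf_gaussianReal hv
  have hna := nullSingletonClass_gaussianReal (μ := 0) hv
  have h := cdf_gaussianReal_eq_stdNormalCDF hv x
  rw [Real.coe_toNNReal _ hV.le] at h
  rw [← h]
  refine tendsto_order.2 ⟨fun c hcx => ?_, fun c hcx => ?_⟩
  · obtain ⟨b, hb, hbx⟩ := (((hc.tendsto x).mono_left nhdsWithin_le_nhds).eventually_const_lt hcx
      |>.and (self_mem_nhdsWithin (s := Set.Iio x))).exists
    exact eventually_lt_infoCDF hP (measure_singleton b) hb hT
      ((ha.eventually_const_lt hbx).mono fun _ => le_of_lt)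
  · obtain ⟨b, hb, hbx⟩ := (((hc.tendsto x).mono_left nhdsWithin_le_nhds).eventually_lt_const hcx
      |>.and (self_mem_nhdsWithin (s := Set.Ioi x))).exists
    exact eventually_infoCDF_lt hP (measure_singleton b) hb hT
      ((ha.eventually_lt_const hbx).mono fun _ => le_of_lt)

/-! ### Positivity of entropy and varentropy -/

section Positivity

theorem term_nonneg_of_mem_stdSimplex (hP : P ∈ stdSimplex ℝ X) (x : X) :
    0 ≤ -(P x * Real.logb 2 (P x)) := by
  rw [neg_nonneg]
  refine mul_nonpos_of_nonneg_of_nonpos (hP.1 x) (Real.logb_nonpos one_lt_two (hP.1 x) ?_)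
  simpa using sum_le_one_of_mem_stdSimplex hP {x}

theorem varentropy_pos (hP : P ∈ stdSimplex ℝ X)
    (h : ∃ x x', P x ≠ 0 ∧ P x' ≠ 0 ∧ P x ≠ P x') : 0 < varentropy P := by
  obtain ⟨x, x', hx, hx', hne⟩ := h
  have hnn : ∀ x ∈ Finset.univ, 0 ≤ P x * (-Real.logb 2 (P x) - entropy P) ^ 2 :=
    fun x _ => mul_nonneg (hP.1 x) (sq_nonneg _)
  refine lt_of_le_of_ne (Finset.sum_nonneg hnn) fun h0 => hne ?_
  have h1 := (Finset.sum_eq_zero_iff_of_nonneg hnn).1 h0.symm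
  have h2 : ∀ x, P x ≠ 0 → Real.logb 2 (P x) = -entropy P := fun x hx => by
    have := h1 x (Finset.mem_univ x)
    have := pow_eq_zero_iff two_ne_zero |>.1 ((mul_eq_zero.1 this).resolve_left hx)
    linarith
  have hpos : ∀ x, P x ≠ 0 → P x ∈ Set.Ioi (0 : ℝ) := fun x hx =>
    lt_of_le_of_ne (hP.1 x) hx.symm
  exact Real.logb_injOn_pos one_lt_two (hpos x hx) (hpos x' hx') ((h2 x hx).trans (h2 x' hx').symm)

theorem entropy_pos (hP : P ∈ stdSimplex ℝ X)
    (h : ∃ x x', P x ≠ 0 ∧ P x' ≠ 0 ∧ P x ≠ P x') : 0 < entropy P := by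
  obtain ⟨x, x', hx, hx', hne⟩ := h
  have hnn := fun x (_ : x ∈ Finset.univ) => term_nonneg_of_mem_stdSimplex hP x
  rw [entropy, ← Finset.sum_neg_distrib]
  refine lt_of_le_of_ne (Finset.sum_nonneg hnn) fun h0 => hne ?_
  have h1 := (Finset.sum_eq_zero_iff_of_nonneg hnn).1 h0.symm
  have h2 : ∀ x, P x ≠ 0 → P x = 1 := fun x hx => by
    have := neg_eq_zero.1 (h1 x (Finset.mem_univ x))
    rcases Real.logb_eq_zero.1 ((mul_eq_zero.1 this).resolve_left hx) with h | h | h | h | h | h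
    · norm_num at h
    · norm_num at h
    · norm_num at h
    · exact absurd h hx
    · exact h
    · linarith [hP.1 x]
  rw [h2 x hx, h2 x' hx']

end Positivity

end RNC

namespace RNC

open Topology

/-! ### Asymptotics of rate sequences -/

section Rates

theorem tendsto_sqrt_natCast : Tendsto (fun n : ℕ => √(n : ℝ)) atTop atTop :=
  Real.tendsto_sqrt_atTop.comp tendsto_natCast_atTop_atTop

/-- `√√n` serves as the slack `c`: it diverges, so `2 ^ (-c)` vanishes, yet it is negligible against
`√n`. -/
theorem tendsto_sqrt_sqrt_natCast : Tendsto (fun n : ℕ => √√(n : ℝ)) atTop atTop :=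
  Real.tendsto_sqrt_atTop.comp tendsto_sqrt_natCast

theorem tendsto_sqrt_sqrt_div_sqrt :
    Tendsto (fun n : ℕ => √√(n : ℝ) / √(n : ℝ)) atTop (𝓝 0) := by
  have h : ∀ n : ℕ, (√√(n : ℝ))⁻¹ = √√(n : ℝ) / √(n : ℝ) := fun n => by
    rw [Real.sqrt_div_self]
  exact (tendsto_inv_atTop_zero.comp tendsto_sqrt_sqrt_natCast).congr h

theorem tendsto_sqrt_div_natCast : Tendsto (fun n : ℕ => √(n : ℝ) / n) atTop (𝓝 0) := by
  have h : ∀ n : ℕ, (√(n : ℝ))⁻¹ = √(n : ℝ) / n := fun n => by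
    rw [Real.sqrt_div_self]
  exact (tendsto_inv_atTop_zero.comp tendsto_sqrt_natCast).congr h

theorem tendsto_two_rpow_neg_sqrt_sqrt :
    Tendsto (fun n : ℕ => (2 : ℝ) ^ (-√√(n : ℝ))) atTop (𝓝 0) := by
  have h := tendsto_rpow_atBot_of_base_gt_one 2 one_lt_two
  exact h.comp (tendsto_neg_atTop_atBot.comp tendsto_sqrt_sqrt_natCast)

theorem eventually_natCast_pos : ∀ᶠ n : ℕ in atTop, 0 < (n : ℝ) :=
  (eventually_gt_atTop 0).mono fun _ h => Nat.cast_pos.2 h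

theorem hasRate_iff {S : ℕ → ℕ} {s : ℝ} :
    HasRate S s ↔ Tendsto (fun n : ℕ => (S n : ℝ) / n) atTop (𝓝 s) := by
  rw [HasRate, isLittleO_iff_tendsto' (eventually_natCast_pos.mono fun n hn h => (hn.ne' h).elim)]
  have h : ∀ᶠ n : ℕ in atTop, (S n : ℝ) / n = ((S n : ℝ) - s * n) / n + s := by
    filter_upwards [eventually_natCast_pos] with n hn
    field_simp
    ring
  rw [tendsto_congr' h]
  constructor
  · intro h
    simpa using h.add_const s
  · intro h
    simpa using h.add_const (-s)

theorem hasRate₂_iff {S : ℕ → ℕ} {s₁ s₂ : ℝ} :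
    HasRate₂ S s₁ s₂ ↔
      Tendsto (fun n : ℕ => ((S n : ℝ) - (s₁ * n + s₂ * √n)) / √n) atTop (𝓝 0) :=
  isLittleO_iff_tendsto' (eventually_natCast_pos.mono fun _ hn h =>
    ((Real.sqrt_pos.2 hn).ne' h).elim)

theorem tendsto_floor_sub_div_sqrt {g : ℕ → ℝ} (hg : ∀ᶠ n in atTop, 0 ≤ g n) :
    Tendsto (fun n : ℕ => ((⌊g n⌋₊ : ℝ) - g n) / √(n : ℝ)) atTop (𝓝 0) := by
  refine squeeze_zero_norm' ?_ (tendsto_inv_atTop_zero.comp tendsto_sqrt_natCast)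
  filter_upwards [hg] with n hn
  rw [norm_div, Real.norm_of_nonneg (Real.sqrt_nonneg _), Function.comp_apply, inv_eq_one_div]
  refine div_le_div_of_nonneg_right ?_ (Real.sqrt_nonneg _)
  rw [Real.norm_eq_abs, abs_le]
  constructor <;> linarith [Nat.floor_le hn, Nat.lt_floor_add_one (g n)]

theorem eventually_nonneg_of_tendsto_div {g : ℕ → ℝ} {s : ℝ} (hs : 0 < s)
    (hg : Tendsto (fun n : ℕ => g n / n) atTop (𝓝 s)) : ∀ᶠ n in atTop, 0 ≤ g n := by
  filter_upwards [hg.eventually_const_lt hs, eventually_natCast_pos] with n h hn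
  exact ((div_pos_iff_of_pos_right hn).1 h).le

theorem hasRate_of_sub_div_sqrt {S : ℕ → ℕ} {g : ℕ → ℝ} {s : ℝ}
    (hg : Tendsto (fun n : ℕ => g n / n) atTop (𝓝 s))
    (h : Tendsto (fun n : ℕ => ((S n : ℝ) - g n) / √(n : ℝ)) atTop (𝓝 0)) : HasRate S s := by
  rw [hasRate_iff]
  have := (h.mul tendsto_sqrt_div_natCast).add hg
  rw [zero_mul, zero_add] at this
  refine this.congr' ?_
  filter_upwards [eventually_natCast_pos] with n hn
  have := Real.sqrt_pos.2 hn
  field_simp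
  ring

theorem hasRate_floor {g : ℕ → ℝ} {s : ℝ} (hs : 0 < s)
    (hg : Tendsto (fun n : ℕ => g n / n) atTop (𝓝 s)) : HasRate (fun n => ⌊g n⌋₊) s :=
  hasRate_of_sub_div_sqrt hg (tendsto_floor_sub_div_sqrt (eventually_nonneg_of_tendsto_div hs hg))

theorem tendsto_mul_natCast_div (s : ℝ) :
    Tendsto (fun n : ℕ => s * n / (n : ℝ)) atTop (𝓝 s) := by
  refine tendsto_const_nhds.congr' ?_
  filter_upwards [eventually_natCast_pos] with n hn
  field_simp

theorem tendsto_second_order_div (s₁ s₂ : ℝ) :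
    Tendsto (fun n : ℕ => (s₁ * n + s₂ * √n) / (n : ℝ)) atTop (𝓝 s₁) := by
  have := (tendsto_mul_natCast_div s₁).add (tendsto_sqrt_div_natCast.const_mul s₂)
  rw [mul_zero, add_zero] at this
  refine this.congr fun n => ?_
  ring

theorem HasRate₂.hasRate {S : ℕ → ℕ} {s₁ s₂ : ℝ} (h : HasRate₂ S s₁ s₂) : HasRate S s₁ :=
  hasRate_of_sub_div_sqrt (tendsto_second_order_div s₁ s₂) (hasRate₂_iff.1 h)

theorem hasRate₂_rateSeq {s₁ : ℝ} (hs : 0 < s₁) (s₂ : ℝ) : HasRate₂ (rateSeq s₁ s₂) s₁ s₂ :=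
  hasRate₂_iff.2 (tendsto_floor_sub_div_sqrt
    (eventually_nonneg_of_tendsto_div hs (tendsto_second_order_div s₁ s₂)))

theorem HasRate.tendsto_atTop {T : ℕ → ℕ} {t : ℝ} (hT : HasRate T t) (ht : 0 < t) :
    Tendsto T atTop atTop := by
  rw [← tendsto_natCast_atTop_iff (R := ℝ)]
  refine ((hasRate_iff.1 hT).pos_mul_atTop ht tendsto_natCast_atTop_atTop).congr' ?_
  filter_upwards [eventually_natCast_pos] with n hn
  field_simp

theorem HasRate.tendsto_inv_sqrt {T : ℕ → ℕ} {t : ℝ} (hT : HasRate T t) (ht : 0 < t) :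
    Tendsto (fun n : ℕ => (√((T n : ℝ) / n))⁻¹) atTop (𝓝 (√t)⁻¹) :=
  ((hasRate_iff.1 hT).sqrt).inv₀ (Real.sqrt_pos.2 ht).ne'

theorem div_sqrt_eventuallyEq (T : ℕ → ℕ) (d : ℕ → ℝ) :
    (fun n : ℕ => d n / √n * (√((T n : ℝ) / n))⁻¹) =ᶠ[atTop] fun n => d n / √(T n : ℝ) := by
  filter_upwards [eventually_natCast_pos] with n hn
  have := Real.sqrt_pos.2 hn
  rw [Real.sqrt_div (Nat.cast_nonneg _), inv_div, div_mul_div_comm, mul_comm √(n : ℝ),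
    mul_div_mul_right _ _ this.ne']

variable {T : ℕ → ℕ} {t : ℝ} {d : ℕ → ℝ}

theorem HasRate.tendsto_div_sqrt (hT : HasRate T t) (ht : 0 < t) {x : ℝ}
    (hd : Tendsto (fun n : ℕ => d n / √(n : ℝ)) atTop (𝓝 x)) :
    Tendsto (fun n => d n / √(T n : ℝ)) atTop (𝓝 (x / √t)) :=
  (hd.mul (hT.tendsto_inv_sqrt ht)).congr' (div_sqrt_eventuallyEq T d)

theorem HasRate.tendsto_div_sqrt_atTop (hT : HasRate T t) (ht : 0 < t)
    (hd : Tendsto (fun n : ℕ => d n / √(n : ℝ)) atTop atTop) :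
    Tendsto (fun n => d n / √(T n : ℝ)) atTop atTop :=
  (hd.atTop_mul_pos (inv_pos.2 (Real.sqrt_pos.2 ht)) (hT.tendsto_inv_sqrt ht)).congr'
    (div_sqrt_eventuallyEq T d)

theorem HasRate.tendsto_div_sqrt_atBot (hT : HasRate T t) (ht : 0 < t)
    (hd : Tendsto (fun n : ℕ => d n / √(n : ℝ)) atTop atBot) :
    Tendsto (fun n => d n / √(T n : ℝ)) atTop atBot :=
  (hd.atBot_mul_pos (inv_pos.2 (Real.sqrt_pos.2 ht)) (hT.tendsto_inv_sqrt ht)).congr'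
    (div_sqrt_eventuallyEq T d)

theorem div_natCast_mul_sqrt_eventuallyEq (d : ℕ → ℝ) :
    (fun n : ℕ => d n / n * √n) =ᶠ[atTop] fun n => d n / √(n : ℝ) := by
  filter_upwards [eventually_natCast_pos] with n hn
  rw [div_mul_eq_mul_div, mul_div_assoc, Real.sqrt_div_self, div_eq_mul_inv]

theorem tendsto_div_sqrt_atBot_of_div {α : ℝ} (hα : α < 0)
    (hd : Tendsto (fun n : ℕ => d n / n) atTop (𝓝 α)) :
    Tendsto (fun n : ℕ => d n / √(n : ℝ)) atTop atBot :=
  (hd.neg_mul_atTop hα tendsto_sqrt_natCast).congr' (div_natCast_mul_sqrt_eventuallyEq d)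

theorem tendsto_div_sqrt_atTop_of_div {α : ℝ} (hα : 0 < α)
    (hd : Tendsto (fun n : ℕ => d n / n) atTop (𝓝 α)) :
    Tendsto (fun n : ℕ => d n / √(n : ℝ)) atTop atTop :=
  (hd.pos_mul_atTop hα tendsto_sqrt_natCast).congr' (div_natCast_mul_sqrt_eventuallyEq d)

theorem hasRate_id : HasRate (fun n => n) 1 :=
  hasRate_iff.2 (by simpa using tendsto_mul_natCast_div 1)

theorem tendsto_sqrt_sqrt_div_natCast :
    Tendsto (fun n : ℕ => √√(n : ℝ) / n) atTop (𝓝 0) := by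
  have := tendsto_sqrt_sqrt_div_sqrt.mul tendsto_sqrt_div_natCast
  rw [zero_mul] at this
  refine this.congr' ?_
  filter_upwards [eventually_natCast_pos] with n hn
  have := (Real.sqrt_pos.2 hn).ne'
  field_simp

theorem tendsto_sqrt_mul_sqrt_sqrt_div_natCast :
    Tendsto (fun n : ℕ => √(n : ℝ) * √√(n : ℝ) / n) atTop (𝓝 0) := by
  refine tendsto_sqrt_sqrt_div_sqrt.congr fun n => ?_
  rw [mul_comm, mul_div_assoc, Real.sqrt_div_self (x := (n : ℝ)), div_eq_mul_inv]

end Rates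

/-! ### First-order rates -/

section FirstOrder

variable {X Y : Type*} [Fintype X] [Fintype Y] {P : X → ℝ} {Q : Y → ℝ}

theorem tendsto_infoCDF_zero_of_rate (hQ : Q ∈ stdSimplex ℝ Y) {T : ℕ → ℕ} {t : ℝ}
    (hT : HasRate T t) (ht : 0 < t) {a : ℕ → ℝ} {α : ℝ}
    (ha : Tendsto (fun n : ℕ => a n / n) atTop (𝓝 α)) (hα : α < t * entropy Q) :
    Tendsto (fun n => infoCDF Q (T n) (a n)) atTop (𝓝 0) := by
  refine tendsto_infoCDF_zero hQ (hT.tendsto_atTop ht) (hT.tendsto_div_sqrt_atBot ht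
    (tendsto_div_sqrt_atBot_of_div (sub_neg.2 hα) ?_))
  refine (ha.sub ((hasRate_iff.1 hT).mul_const _)).congr fun n => ?_
  ring

theorem tendsto_infoCDF_one_of_rate (hQ : Q ∈ stdSimplex ℝ Y) {T : ℕ → ℕ} {t : ℝ}
    (hT : HasRate T t) (ht : 0 < t) {a : ℕ → ℝ} {α : ℝ}
    (ha : Tendsto (fun n : ℕ => a n / n) atTop (𝓝 α)) (hα : t * entropy Q < α) :
    Tendsto (fun n => infoCDF Q (T n) (a n)) atTop (𝓝 1) := by
  refine tendsto_infoCDF_one hQ (hT.tendsto_atTop ht) (hT.tendsto_div_sqrt_atTop ht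
    (tendsto_div_sqrt_atTop_of_div (sub_pos.2 hα) ?_))
  refine (ha.sub ((hasRate_iff.1 hT).mul_const _)).congr fun n => ?_
  ring

theorem asympFidelity_eq_zero_of_le {i : ConvType} {S T : ℕ → ℕ} {u : ℕ → ℝ}
    (hu : Tendsto u atTop (𝓝 0))
    (h : ∀ n, maxFidelity i (iid P n) (iid Q (T n)) (S n) ≤ u n) :
    asympFidelity i P Q S T = 0 :=
  (squeeze_zero (fun _ => maxFidelity_nonneg _ _ _ _) h hu).liminf_eq

theorem HasRate.tendsto_add_sqrt_sqrt_div {S : ℕ → ℕ} {s : ℝ} (hS : HasRate S s) :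
    Tendsto (fun n : ℕ => ((S n : ℝ) + √√(n : ℝ)) / n) atTop (𝓝 s) := by
  simpa [add_div] using (hasRate_iff.1 hS).add tendsto_sqrt_sqrt_div_natCast

theorem tendsto_sqrt_infoCDF_add_zero (hQ : Q ∈ stdSimplex ℝ Y) {S T : ℕ → ℕ} {s t : ℝ}
    (hS : HasRate S s) (hT : HasRate T t) (ht : 0 < t) (h : s < t * entropy Q) :
    Tendsto (fun n : ℕ => √(infoCDF Q (T n) (S n + √√(n : ℝ)) + 2 ^ (-√√(n : ℝ)))) atTop
      (𝓝 0) := by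
  simpa using ((tendsto_infoCDF_zero_of_rate hQ hT ht hS.tendsto_add_sqrt_sqrt_div h).add
    tendsto_two_rpow_neg_sqrt_sqrt).sqrt

theorem entropy_nonneg (hP : P ∈ stdSimplex ℝ X) : 0 ≤ entropy P := by
  rw [entropy, ← Finset.sum_neg_distrib]
  exact Finset.sum_nonneg fun x _ => term_nonneg_of_mem_stdSimplex hP x

theorem mul_entropy_le_of_mem_firstOrderRegion (hP : P ∈ stdSimplex ℝ X)
    (hQ : Q ∈ stdSimplex ℝ Y) {i : ConvType} {ν : ℝ} (hν : 0 < ν) {r : ℝ × ℝ}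
    (hr : r ∈ firstOrderRegion i P Q ν) :
    r.2 * entropy Q ≤ r.1 ∧ r.2 * entropy Q ≤ entropy P := by
  obtain ⟨hs, ht, S, T, hS, hT, hach⟩ := hr
  refine ⟨le_of_not_gt fun hlt => ?_, le_of_not_gt fun hlt => ?_⟩
  · have := asympFidelity_eq_zero_of_le (tendsto_sqrt_infoCDF_add_zero hQ hS hT ht hlt)
      fun n => maxFidelity_iid_le_sqrt hP hQ i n (T n) (S n) _
    rw [Achievable, this] at hach
    linarith
  -- About `2 ^ (h * n)` words then carry almost all of the source but a vanishing part of the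
  -- target.
  · obtain ⟨h, hPh, hhQ⟩ := exists_between hlt
    have hk := hasRate_floor ((entropy_nonneg hP).trans_lt hPh) (tendsto_mul_natCast_div h)
    have h1 := tendsto_infoCDF_one_of_rate hP hasRate_id one_pos (hasRate_iff.1 hk)
      (by rwa [one_mul])
    have h2 := (tendsto_const_nhds (x := (1 : ℝ))).sub h1
    have h3 := (tendsto_sqrt_infoCDF_add_zero hQ hk hT ht hhQ).add h2.sqrt
    rw [sub_self, Real.sqrt_zero, add_zero] at h3
    have := asympFidelity_eq_zero_of_le h3 fun n =>
      maxFidelity_iid_le_add_sqrt hP hQ i n (T n) (S n) ⌊h * n⌋₊ _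
    rw [Achievable, this] at hach
    linarith

theorem tendsto_lower_bound {S T : ℕ → ℕ} {φ : ℝ}
    (hQ : Tendsto (fun n : ℕ => infoCDF Q (T n) (S n - √√(n : ℝ))) atTop (𝓝 φ))
    (hP : Tendsto (fun n : ℕ => infoCDF P n (S n)) atTop (𝓝 0)) :
    Tendsto (fun n : ℕ => √(infoCDF Q (T n) (S n - √√(n : ℝ)) *
      (1 - infoCDF P n (S n) - 2 ^ (-√√(n : ℝ))))) atTop (𝓝 (√φ)) := by
  simpa using (hQ.mul (((tendsto_const_nhds (x := (1 : ℝ))).sub hP).sub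
    tendsto_two_rpow_neg_sqrt_sqrt)).sqrt

theorem maxFidelity_le_one (hP : P ∈ stdSimplex ℝ X) (hQ : Q ∈ stdSimplex ℝ Y) (i : ConvType)
    (N : ℕ) : maxFidelity i P Q N ≤ 1 :=
  (maxFidelity_le_fidelityMaj hP hQ i N).trans
    ((fidelityMaj_le_sqrt_topSum hQ N).trans (Real.sqrt_le_one.2
      (topSum_le fun A _ => sum_le_one_of_mem_stdSimplex hQ A)))

/-- The boundary is attained, even at `t * entropy Q = entropy P`, by corrections of order `n ^ (3 /
4)`, which exceed the Gaussian fluctuations but leave the rates unchanged. -/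
theorem mem_firstOrderRegion_of_mul_entropy_le (hP : P ∈ stdSimplex ℝ X)
    (hQ : Q ∈ stdSimplex ℝ Y) (hH : 0 < entropy Q) (i : ConvType) {ν : ℝ} (hν : ν ≤ 1) {t : ℝ}
    (ht : 0 < t) (h : t * entropy Q ≤ entropy P) :
    (t * entropy Q, t) ∈ firstOrderRegion i P Q ν := by
  set s := t * entropy Q with hs
  have hs₀ : 0 < s := mul_pos ht hH
  -- The storage stays `n ^ (3 / 4)` below `s * n`, so source atoms are light even if `s = entropy
  -- P`. The constant `3` leaves it `2 * n ^ (3 / 4)` above the entropy of the shortened target.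
  set gS : ℕ → ℝ := fun n => s * n - √(n : ℝ) * √√(n : ℝ) with hgS
  set gT : ℕ → ℝ := fun n => t * n - 3 / entropy Q * (√(n : ℝ) * √√(n : ℝ)) with hgT
  have hgS' : Tendsto (fun n : ℕ => gS n / n) atTop (𝓝 s) := by
    simpa [hgS, sub_div] using
      (tendsto_mul_natCast_div s).sub tendsto_sqrt_mul_sqrt_sqrt_div_natCast
  have hgT' : Tendsto (fun n : ℕ => gT n / n) atTop (𝓝 t) := by
    simpa [hgT, sub_div, mul_div_assoc] using (tendsto_mul_natCast_div t).sub
      (tendsto_sqrt_mul_sqrt_sqrt_div_natCast.const_mul (3 / entropy Q))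
  have hfS := tendsto_floor_sub_div_sqrt (eventually_nonneg_of_tendsto_div hs₀ hgS')
  have hfT := tendsto_floor_sub_div_sqrt (eventually_nonneg_of_tendsto_div ht hgT')
  have hS := hasRate_floor hs₀ hgS'
  have hT := hasRate_floor ht hgT'
  refine ⟨hs₀, ht, _, _, hS, hT, ?_⟩
  have h1 : Tendsto (fun n : ℕ => infoCDF Q ⌊gT n⌋₊ ((⌊gS n⌋₊ : ℝ) - √√(n : ℝ))) atTop (𝓝 1) := by
    refine tendsto_infoCDF_one hQ (hT.tendsto_atTop ht) (hT.tendsto_div_sqrt_atTop ht ?_)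
    refine (((hfS.sub (hfT.mul_const (entropy Q))).sub tendsto_sqrt_sqrt_div_sqrt).add_atTop
      (tendsto_sqrt_sqrt_natCast.const_mul_atTop two_pos)).congr' ?_
    filter_upwards [eventually_natCast_pos] with n hn
    have := (Real.sqrt_pos.2 hn).ne'
    simp only [hgS, hgT, hs]
    field_simp
    ring
  have h2 : Tendsto (fun n : ℕ => infoCDF P n (⌊gS n⌋₊ : ℝ)) atTop (𝓝 0) := by
    refine tendsto_infoCDF_zero hP tendsto_id ?_
    refine tendsto_atBot_mono' _ ?_
      (hfS.add_atBot (tendsto_neg_atTop_atBot.comp tendsto_sqrt_sqrt_natCast))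
    filter_upwards [eventually_natCast_pos] with n hn
    have hn' := Real.sqrt_pos.2 hn
    simp only [Function.comp_apply, id]
    rw [div_add' _ _ _ hn'.ne']
    refine div_le_div_of_nonneg_right ?_ hn'.le
    have := mul_le_mul_of_nonneg_right h hn.le
    simp only [hgS]
    linarith
  have h3 := tendsto_lower_bound h1 h2
  rw [Real.sqrt_one] at h3
  have h4 := tendsto_of_tendsto_of_tendsto_of_le_of_le h3 tendsto_const_nhds
    (fun n => sqrt_le_maxFidelity_iid hP hQ i n ⌊gT n⌋₊ ⌊gS n⌋₊ (Real.sqrt_nonneg √(n : ℝ)))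
    (fun n => maxFidelity_le_one (iid_mem_stdSimplex hP n) (iid_mem_stdSimplex hQ _) i _)
  rw [Achievable, asympFidelity, h4.liminf_eq]
  exact hν

theorem rateBetter_of_le {s s' t : ℝ} (hs : 0 < s') (hss : s' ≤ s) (ht : 0 < t) :
    RateBetter (s', t) (s, t) :=
  have h {u : ℝ} (hu : 0 < u) := hasRate_floor hu (tendsto_mul_natCast_div u)
  ⟨_, _, _, _, h hs, h ht, h (hs.trans_le hss), h ht, Eventually.of_forall fun n =>
    ⟨Nat.floor_le_floor (mul_le_mul_of_nonneg_right hss (Nat.cast_nonneg n)), le_rfl⟩⟩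

theorem RateSimulates.le_and_mul_eq {r r' : ℝ × ℝ} (h : RateSimulates r' r) (hr : 0 < r.1)
    (hr₂ : 0 < r.2) (hr₂' : 0 < r'.2) : r.1 ≤ r'.1 ∧ r.1 * r'.2 = r'.1 * r.2 := by
  obtain ⟨S, T, S', T', hS, hT, hS', hT', k, hk⟩ := h
  have hS'top := hS'.tendsto_atTop hr
  -- `S' n = S (k n)` diverges, whereas `S` is bounded on each initial segment.
  have hktop : Tendsto k atTop atTop := by
    refine tendsto_atTop.2 fun M => ?_
    filter_upwards [hS'top.eventually_gt_atTop ((Finset.range M).sup S),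
      eventually_ge_atTop 1] with n hn h1
    by_contra! hlt
    have := Finset.le_sup (f := S) (Finset.mem_range.2 hlt)
    rw [← (hk n h1).2.2.1] at this
    omega
  rw [hasRate_iff] at hS hT hS' hT'
  have hSk := hS.comp hktop
  have hTk := hT.comp hktop
  constructor
  · refine le_of_tendsto_of_tendsto hS' hSk ?_
    filter_upwards [eventually_ge_atTop 1] with n h1
    obtain ⟨hk1, hkn, hkS, -⟩ := hk n h1
    rw [Function.comp_apply, hkS]
    exact div_le_div_of_nonneg_left (Nat.cast_nonneg _) (by exact_mod_cast hk1)
      (by exact_mod_cast hkn)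
  · have h1 := hS'.div hT' hr₂.ne'
    have h2 := hSk.div hTk hr₂'.ne'
    rw [← div_eq_div_iff hr₂.ne' hr₂'.ne']
    refine tendsto_nhds_unique h1 (h2.congr' ?_)
    filter_upwards [eventually_ge_atTop 1] with n hn
    obtain ⟨hk1, hkn, hkS, hkT⟩ := hk n hn
    have hk0 : (k n : ℝ) ≠ 0 := by positivity
    have hn0 : (n : ℝ) ≠ 0 := by positivity
    simp only [Pi.div_apply, Function.comp_apply, hkS, hkT]
    rw [div_div_div_cancel_right₀ hk0, div_div_div_cancel_right₀ hn0]

/-- The achievable pair `(t * entropy Q, t)` is better, hence equal. If moreover `s = entropy P`, a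
simulating pair lies on the same ray with first rate at least `s`, and the converse bound caps that
rate at `entropy P`; so it coincides with `(s, t)`. -/
theorem SemiAdmissible.rates_of_not_admissible (hP : P ∈ stdSimplex ℝ X)
    (hQ : Q ∈ stdSimplex ℝ Y) (hH : 0 < entropy Q) {i : ConvType} {ν : ℝ}
    (hν : ν ∈ Set.Ioo (0 : ℝ) 1) {s t : ℝ} (h : SemiAdmissible i P Q ν (s, t))
    (h' : ¬ Admissible i P Q ν (s, t)) :
    0 < s ∧ s < entropy P ∧ t = s / entropy Q := by
  obtain ⟨hmem, hbest⟩ := h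
  have hs : 0 < s := hmem.1
  have ht : 0 < t := hmem.2.1
  obtain ⟨h1, h2⟩ := mul_entropy_le_of_mem_firstOrderRegion hP hQ hν.1 hmem
  have hst : t * entropy Q = s := congrArg Prod.fst
    (hbest _ (mem_firstOrderRegion_of_mul_entropy_le hP hQ hH i hν.2.le ht h2)
      (rateBetter_of_le (mul_pos ht hH) h1 ht))
  refine ⟨hs, lt_of_le_of_ne (hst ▸ h2) fun hsP => h' ⟨hmem, ?_⟩, by rw [← hst]; field_simp⟩
  rintro r hr (hb | hsim)
  · exact hbest r hr hb
  · obtain ⟨hle, hmul⟩ := hsim.le_and_mul_eq hs ht hr.2.1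
    have hrP := (mul_entropy_le_of_mem_firstOrderRegion hP hQ hν.1 hr).2
    have hr1 : r.2 * entropy Q = r.1 := by
      refine mul_right_cancel₀ ht.ne' ?_
      linear_combination r.2 * hst + hmul
    have hrs : r.1 = s := le_antisymm (by rw [← hr1, hsP]; exact hrP) hle
    refine Prod.ext hrs (mul_right_cancel₀ hH.ne' ?_)
    rw [hr1, hst, hrs]

end FirstOrder

/-! ### Second-order rates -/

section SecondOrder

variable {X Y : Type*} [Fintype X] [Fintype Y] {P : X → ℝ} {Q : Y → ℝ}

theorem div_sqrt_div_sqrt_eq {H V s x : ℝ} (hH : 0 < H) (hV : 0 < V) (hs : 0 < s) :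
    x / √(s / H) / √V = √(H / (V * s)) * x := by
  rw [div_div, ← Real.sqrt_mul (div_nonneg hs.le hH.le), div_eq_inv_mul, ← Real.sqrt_inv]
  congr 2
  field_simp

/-- Standardizing by `√(T n)`, with `T n ~ s₁ * n / H(Q)`, and by `√V(Q)` produces the constant in
front; the slack `c` disappears in the limit. -/
theorem tendsto_infoCDF_second_order (hQ : Q ∈ stdSimplex ℝ Y) (hH : 0 < entropy Q)
    (hV : 0 < varentropy Q) {s₁ s₂ t₂ : ℝ} (hs : 0 < s₁) {S T : ℕ → ℕ} (hS : HasRate₂ S s₁ s₂)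
    (hT : HasRate₂ T (s₁ / entropy Q) t₂) {c : ℕ → ℝ}
    (hc : Tendsto (fun n : ℕ => c n / √(n : ℝ)) atTop (𝓝 0)) :
    Tendsto (fun n : ℕ => infoCDF Q (T n) (S n + c n)) atTop (𝓝 (stdNormalCDF
      (√(entropy Q / (varentropy Q * s₁)) * (s₂ - entropy Q * t₂)))) := by
  have ht : 0 < s₁ / entropy Q := div_pos hs hH
  rw [← div_sqrt_div_sqrt_eq hH hV hs]
  refine tendsto_infoCDF hQ hV (hT.hasRate.tendsto_atTop ht) (hT.hasRate.tendsto_div_sqrt ht ?_)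
  have h := (((hasRate₂_iff.1 hS).add hc).sub ((hasRate₂_iff.1 hT).const_mul (entropy Q))).add_const
    (s₂ - entropy Q * t₂)
  rw [add_zero, mul_zero, sub_zero, zero_add] at h
  refine h.congr' ?_
  filter_upwards [eventually_natCast_pos] with n hn
  have := (Real.sqrt_pos.2 hn).ne'
  field_simp
  ring

/-- Storage converse and binning bound have the same limit, because `s₁ < entropy P` makes the
source mass on words heavier than the binning threshold vanish. -/
theorem asympFidelity_eq_gaussianFidelity (hP : P ∈ stdSimplex ℝ X) (hQ : Q ∈ stdSimplex ℝ Y)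
    (hH : 0 < entropy Q) (hV : 0 < varentropy Q) {s₁ s₂ t₂ : ℝ} (hs : 0 < s₁)
    (hsP : s₁ < entropy P) (i : ConvType) {S T : ℕ → ℕ} (hS : HasRate₂ S s₁ s₂)
    (hT : HasRate₂ T (s₁ / entropy Q) t₂) :
    asympFidelity i P Q S T = gaussianFidelity Q s₁ s₂ t₂ := by
  have hlow := tendsto_infoCDF_second_order hQ hH hV hs hS hT (c := fun n => -√√(n : ℝ))
    (by simpa [neg_div] using tendsto_sqrt_sqrt_div_sqrt.neg)
  have hupp := tendsto_infoCDF_second_order hQ hH hV hs hS hT tendsto_sqrt_sqrt_div_sqrt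
  have h0 := tendsto_infoCDF_zero_of_rate hP hasRate_id one_pos (hasRate_iff.1 hS.hasRate)
    (by rwa [one_mul])
  have hupp' := (hupp.add tendsto_two_rpow_neg_sqrt_sqrt).sqrt
  rw [add_zero] at hupp'
  exact (tendsto_of_tendsto_of_tendsto_of_le_of_le (tendsto_lower_bound hlow h0) hupp'
    (fun n => sqrt_le_maxFidelity_iid hP hQ i n (T n) (S n) (Real.sqrt_nonneg √(n : ℝ)))
    (fun n => maxFidelity_iid_le_sqrt hP hQ i n (T n) (S n) _)).liminf_eq

theorem continuous_gaussianFidelity (Q : Y → ℝ) (s₁ s₂ : ℝ) :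
    Continuous fun t₂ => gaussianFidelity Q s₁ s₂ t₂ := by
  have := continuous_stdNormalCDF
  unfold gaussianFidelity
  fun_prop

theorem strictAnti_gaussianFidelity (hH : 0 < entropy Q) (hV : 0 < varentropy Q) {s₁ : ℝ}
    (hs : 0 < s₁) (s₂ : ℝ) : StrictAnti fun t₂ => gaussianFidelity Q s₁ s₂ t₂ := by
  intro a b hab
  refine Real.sqrt_lt_sqrt (stdNormalCDF_nonneg _) (strictMono_stdNormalCDF ?_)
  have : 0 < √(entropy Q / (varentropy Q * s₁)) := Real.sqrt_pos.2 (by positivity)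
  gcongr

theorem le_gaussianFidelity_iff (hH : 0 < entropy Q) (hV : 0 < varentropy Q) {s₁ : ℝ}
    (hs : 0 < s₁) (s₂ t₂ : ℝ) {ν : ℝ} (hν : ν ∈ Set.Ioo (0 : ℝ) 1) :
    ν ≤ gaussianFidelity Q s₁ s₂ t₂ ↔
      t₂ ≤ s₂ / entropy Q - √(varentropy Q * s₁ / entropy Q ^ 3) * stdNormalInv (ν ^ 2) := by
  set H := entropy Q
  set V := varentropy Q
  set z := stdNormalInv (ν ^ 2) with hz
  have hz' : stdNormalCDF z = ν ^ 2 :=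
    stdNormalCDF_stdNormalInv ⟨by have := hν.1; positivity, by nlinarith [hν.1, hν.2]⟩
  have hc : √(V * s₁ / H ^ 3) = (√(H / (V * s₁)) * H)⁻¹ := by
    rw [← Real.sqrt_sq hH.le, ← Real.sqrt_mul (by positivity), ← Real.sqrt_inv,
      Real.sqrt_sq hH.le]
    congr 1
    field_simp
  have ha : 0 < √(H / (V * s₁)) := Real.sqrt_pos.2 (by positivity)
  rw [gaussianFidelity, Real.le_sqrt' hν.1, ← hz', strictMono_stdNormalCDF.le_iff_le, hc]
  have key : √(H / (V * s₁)) * (s₂ - H * t₂) - z =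
      √(H / (V * s₁)) * H * (s₂ / H - (√(H / (V * s₁)) * H)⁻¹ * z - t₂) := by
    field_simp
    ring
  rw [← sub_nonneg, key, mul_nonneg_iff_of_pos_left (by positivity), sub_nonneg]

end SecondOrder

end RNC

theorem mainTheorem5 {X Y : Type*} [Fintype X] [Fintype Y] (P : X → ℝ) (Q : Y → ℝ)
    (hP : P ∈ stdSimplex ℝ X) (hQ : Q ∈ stdSimplex ℝ Y)
    -- `Q` is not the uniform distribution on its support, i.e. `V(Q) ≠ 0`
    (hQ_nonuniform : ∃ y y' : Y, Q y ≠ 0 ∧ Q y' ≠ 0 ∧ Q y ≠ Q y')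
    (s₁ t₁ : ℝ) (i₀ : RNC.ConvType) (ν₀ : ℝ) (hν₀ : ν₀ ∈ Set.Ioo (0 : ℝ) 1)
    (h_semi : RNC.SemiAdmissible i₀ P Q ν₀ (s₁, t₁))
    (h_not_adm : ¬ RNC.Admissible i₀ P Q ν₀ (s₁, t₁)) :
    (0 < s₁ ∧ s₁ < RNC.entropy P ∧ t₁ = s₁ / RNC.entropy Q) ∧
    (∀ s₂ : ℝ,
      Continuous (fun t₂ : ℝ => RNC.gaussianFidelity Q s₁ s₂ t₂) ∧
      StrictAntiOn (fun t₂ : ℝ => RNC.gaussianFidelity Q s₁ s₂ t₂)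
        ((fun t₂ : ℝ => RNC.gaussianFidelity Q s₁ s₂ t₂) ⁻¹' Set.Ioo (0 : ℝ) 1) ∧
      ∀ (i : RNC.ConvType) (t₂ : ℝ),
        RNC.secondOrderFidelity i P Q s₁ t₁ s₂ t₂ = RNC.gaussianFidelity Q s₁ s₂ t₂ ∧
        ∀ S T : ℕ → ℕ, RNC.HasRate₂ S s₁ s₂ → RNC.HasRate₂ T t₁ t₂ →
          RNC.asympFidelity i P Q S T = RNC.gaussianFidelity Q s₁ s₂ t₂) ∧
    (∀ (i : RNC.ConvType) (ν : ℝ), ν ∈ Set.Ioo (0 : ℝ) 1 →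
      RNC.secondOrderRegion i P Q s₁ t₁ ν =
        {r : ℝ × ℝ | r.2 ≤ r.1 / RNC.entropy Q -
          Real.sqrt (RNC.varentropy Q * s₁ / RNC.entropy Q ^ 3) *
            RNC.stdNormalInv (ν ^ 2)}) := by
  have hH := RNC.entropy_pos hQ hQ_nonuniform
  have hV := RNC.varentropy_pos hQ hQ_nonuniform
  obtain ⟨hs, hsP, rfl⟩ := h_semi.rates_of_not_admissible hP hQ hH hν₀ h_not_adm
  have hseq (i : RNC.ConvType) {s₂ t₂ : ℝ} {S T : ℕ → ℕ} (hS : RNC.HasRate₂ S s₁ s₂)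
      (hT : RNC.HasRate₂ T (s₁ / RNC.entropy Q) t₂) :=
    RNC.asympFidelity_eq_gaussianFidelity hP hQ hH hV hs hsP i hS hT
  have hsecond (i : RNC.ConvType) (s₂ t₂ : ℝ) :
      RNC.secondOrderFidelity i P Q s₁ (s₁ / RNC.entropy Q) s₂ t₂ =
        RNC.gaussianFidelity Q s₁ s₂ t₂ :=
    hseq i (RNC.hasRate₂_rateSeq hs s₂) (RNC.hasRate₂_rateSeq (div_pos hs hH) t₂)
  refine ⟨⟨hs, hsP, rfl⟩, fun s₂ => ⟨RNC.continuous_gaussianFidelity Q s₁ s₂,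
    (RNC.strictAnti_gaussianFidelity hH hV hs s₂).strictAntiOn _,
    fun i t₂ => ⟨hsecond i s₂ t₂, fun S T => hseq i⟩⟩, fun i ν hν => ?_⟩
  ext r
  rw [RNC.secondOrderRegion, Set.mem_ofPred_eq, hsecond]
  exact RNC.le_gaussianFidelity_iff hH hV hs r.1 r.2 hν
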